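/- Let $\theta\in\mathbb R$, $\lambda=e^{2\pi i\theta}$, $\mu=e^{\pi i\theta}$, and let $n\ge 1$ be an integer. *The algebras.* $A(S^4_\theta)$ is the unital complex $*$-algebra generated by $z_0=z_0^*,z_1,z_2$ with relations $z_jz_k=\lambda_{jk}z_kz_j$, $z_jz_k^*=\lambda_{kj}z_k^*z_j$, $z_j^*z_k^*=\lambda_{jk}z_k^*z_j^*$ and $\sum_j z_j^*z_j=1$ ($j,k=0,1,2$), where $\lambda_{12}=\overline{\lambda_{21}}=\lambda$ and all other $\lambda_{jk}=1$. $A(S^7_{\theta'})$ is the unital complex $*$-algebra generated by $\psi_1,\dots,\psi_4$ with relations $\psi_a\psi_b=\lambda'_{ab}\psi_b\psi_a$, $\psi_a\psi_b^*=\lambda'_{ba}\psi_b^*\psi_a$, $\psi_a^*\psi_b^*=\lambda'_{ab}\psi_b^*\psi_a^*$ and $\sum_a\psi_a^*\psi_a=1$, where $$(\lambda'_{ab})=\begin{pmatrix}1&1&\bar\mu&\mu\\1&1&\mu&\bar\mu\\ \mu&\bar\mu&1&1\\ \bar\mu&\mu&1&1\end{pmatrix}.$$ Let $$\Psi=(|\psi_1\rangle,|\psi_2\rangle)=\begin{pmatrix}\psi_1&-\psi_2^*\\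 \psi_2&\psi_1^*\\ \psi_3&-\psi_4^*\\ \psi_4&\psi_3^*\end{pmatrix}.$$ The group $SU(2)$ acts on $A(S^7_{\theta'})$ by $*$-automorphisms $\alpha_w$ with $\alpha_w(\Psi)=\Psi w$. The $*$-homomorphism $A(S^4_\theta)\to A(S^7_{\theta'})$ given by $z_0\mapsto\psi_1^*\psi_1+\psi_2^*\psi_2-\psi_3^*\psi_3-\psi_4^*\psi_4$, $z_1\mapsto 2(\psi_1\psi_3^*+\psi_2^*\psi_4)$, $z_2\mapsto 2(-\psi_1^*\psi_4+\psi_2\psi_3^*)$ takes values in the $SU(2)$-invariant elements. *The modules.* Let $\rho_{(n)}$ be the representation of $SU(2)$ on $W^{(n)}=\mathrm{Sym}^n(\mathbb C^2)\subset(\mathbb C^2)^{\otimes n}$ (symmetric tensors) induced by the defining representation. For $k=1,\dots,n+1$ let $e_k\in W^{(n)}$ be $\binom{n}{k-1}^{-1/2}$ times the sum of the $\binom{n}{k-1}$ distinct tensor products of $n-k+1$ copies of the first and $k-1$ copies of the second standard basis vector of $\mathbb C^2$, and let $|\phi_k\rangle\in A(S^7_{\theta'})^{4^n}$ be $\binom{n}{k-1}^{-1/2}$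 times the sum of the $\binom{n}{k-1}$ distinct tensor products of $n-k+1$ copies of $|\psi_1\rangle$ and $k-1$ copies of $|\psi_2\rangle$. With $\langle\xi|\eta\rangle=\sum_b\xi_b^*\eta_b$, put $p_{(n)}=\sum_{k=1}^{n+1}|\phi_k\rangle\langle\phi_k|$. Let $$A(S^7_{\theta'})\boxtimes_{\rho_{(n)}}W^{(n)}=\{\varphi\in A(S^7_{\theta'})\otimes W^{(n)}:(\alpha_w\otimes\mathrm{id})(\varphi)=(\mathrm{id}\otimes\rho_{(n)}(w)^{-1})(\varphi)\ \text{ for all } w\in SU(2)\},$$ a right $A(S^4_\theta)$-module. *Proposition.* The homomorphism $A(S^4_\theta)\to A(S^7_{\theta'})$ is injective, so that $A(S^4_\theta)$ is a subalgebra of $A(S^7_{\theta'})$. The matrix $p_{(n)}$ has entries in $A(S^4_\theta)$ and is a projection, $p_{(n)}^2=p_{(n)}=p_{(n)}^*$. There is an isomorphism of right $A(S^4_\theta)$-modules $$p_{(n)}\big(A(S^4_\theta)^{4^n}\big)\;\simeq\;A(S^7_{\theta'})\boxtimes_{\rho_{(n)}}W^{(n)},\qquad p_{(n)}|f\rangle\mapsto\sum_{k=1}^{n+1}\langle\phi_k|f\rangle\otimes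 e_k\quad\text{for all } |f\rangle\in A(S^4_\theta)^{4^n}.$$ -/

import Mathlib

open scoped TensorProduct

set_option linter.unusedSectionVars false

noncomputable section

namespace NCHopf

/-! ### Unital `*`-algebras given by generators and relations -/

/-- The complex algebra freely generated by symbols `x` (coded as `(x, false)`) and `x^*`
(coded as `(x, true)`), for `x` in `X`; it is the free unital `*`-algebra on `X`. -/
def FreeStarAlg (X : Type) : Type := FreeAlgebra ℂ (X × Bool)

instance (X : Type) : Ring (FreeStarAlg X) := inferInstanceAs (Ring (FreeAlgebra ℂ (X × Bool)))
instance (X : Type) : Algebra ℂ (FreeStarAlg X) :=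
  inferInstanceAs (Algebra ℂ (FreeAlgebra ℂ (X × Bool)))

/-- The opposite of an algebra, with complex conjugate scalars: antilinear antihomomorphisms into
`A` are the same as algebra homomorphisms into `ConjOp A`. -/
def ConjOp (A : Type) : Type := Aᵐᵒᵖ

instance (A : Type) [Ring A] : Ring (ConjOp A) := inferInstanceAs (Ring Aᵐᵒᵖ)
instance (A : Type) [Ring A] [Algebra ℂ A] : Algebra ℂ (ConjOp A) :=
  ((algebraMap ℂ Aᵐᵒᵖ).comp (starRingEnd ℂ)).toAlgebra' fun c x =>
    Algebra.commutes (R := ℂ) (A := Aᵐᵒᵖ) (starRingEnd ℂ c) x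

namespace FreeStarAlg

variable {X : Type}

/-- The generator `x`, or `x^*` if the flag is `true`. -/
def letter (y : X × Bool) : FreeStarAlg X := FreeAlgebra.ι ℂ y

/-- The generator `x` of the free `*`-algebra. -/
def gen (x : X) : FreeStarAlg X := letter (x, false)

theorem induct {C : FreeStarAlg X → Prop} (h0 : ∀ c : ℂ, C (algebraMap ℂ _ c))
    (h1 : ∀ y, C (letter y)) (h2 : ∀ a b, C a → C b → C (a * b))
    (h3 : ∀ a b, C a → C b → C (a + b)) (a : FreeStarAlg X) : C a :=
  FreeAlgebra.induction (R := ℂ) (X := X × Bool) (motive := C) h0 h1 h2 h3 a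

def starAux : FreeStarAlg X →ₐ[ℂ] ConjOp (FreeStarAlg X) :=
  FreeAlgebra.lift ℂ fun y : X × Bool => MulOpposite.op (letter (y.1, !y.2))

instance : Star (FreeStarAlg X) := ⟨fun a => MulOpposite.unop (starAux a)⟩

theorem star_def (a : FreeStarAlg X) : star a = MulOpposite.unop (starAux a) := rfl

theorem star_mul' (a b : FreeStarAlg X) : star (a * b) = star b * star a := by
  simp only [star_def, map_mul]; rfl

theorem star_add' (a b : FreeStarAlg X) : star (a + b) = star a + star b := by
  simp only [star_def, map_add]; rfl

theorem star_algebraMap' (c : ℂ) :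
    star (algebraMap ℂ (FreeStarAlg X) c) = algebraMap ℂ _ (starRingEnd ℂ c) := by
  rw [star_def, AlgHom.commutes]; rfl

theorem star_letter (y : X × Bool) : star (letter y) = letter (y.1, !y.2) := by
  rw [star_def]
  exact congrArg MulOpposite.unop (FreeAlgebra.lift_ι_apply (R := ℂ) (A := ConjOp (FreeStarAlg X))
    (fun y : X × Bool => MulOpposite.op (letter (y.1, !y.2))) y)

/-- The involution: antilinear, antimultiplicative, exchanging `x` and `x^*`. -/
instance : StarRing (FreeStarAlg X) where
  star_involutive := by
    intro a
    induction a using induct with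
    | h0 c => simp [star_algebraMap']
    | h1 y => simp [star_letter]
    | h2 a b ha hb => rw [star_mul', star_mul', ha, hb]
    | h3 a b ha hb => rw [star_add', star_add', ha, hb]
  star_mul := star_mul'
  star_add := star_add'

instance : StarModule ℂ (FreeStarAlg X) where
  star_smul c a := by
    rw [Algebra.smul_def, star_mul', star_algebraMap', Algebra.smul_def, Algebra.commutes]; rfl

variable {B : Type} [Ring B] [StarRing B] [Algebra ℂ B] [StarModule ℂ B]

def liftAux (g : X → B) : FreeStarAlg X →ₐ[ℂ] B :=
  FreeAlgebra.lift ℂ fun y : X × Bool => if y.2 then star (g y.1) else g y.1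

theorem liftAux_letter (g : X → B) (y : X × Bool) :
    liftAux g (letter y) = if y.2 then star (g y.1) else g y.1 :=
  FreeAlgebra.lift_ι_apply _ _

/-- The `*`-homomorphism out of the free `*`-algebra with given values on the generators. -/
def lift (g : X → B) : FreeStarAlg X →⋆ₐ[ℂ] B where
  __ := liftAux g
  map_star' a := by
    change liftAux g (star a) = star (liftAux g a)
    induction a using induct with
    | h0 c =>
      rw [star_algebraMap', AlgHom.commutes, AlgHom.commutes]
      exact algebraMap_star_comm c
    | h1 y => rcases y with ⟨x, _ | _⟩ <;> simp [star_letter, liftAux_letter]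
    | h2 a b ha hb => simp [ha, hb]
    | h3 a b ha hb => simp [ha, hb]

@[simp] theorem lift_gen (g : X → B) (x : X) : lift g (gen x) = g x :=
  (liftAux_letter g (x, false)).trans (by simp)

@[simp] theorem lift_star_gen (g : X → B) (x : X) : lift g (star (gen x)) = star (g x) := by
  rw [map_star, lift_gen]

end FreeStarAlg

/-- The relations `r` together with their adjoints. -/
inductive StarClosure {X : Type} (r : FreeStarAlg X → FreeStarAlg X → Prop) :
    FreeStarAlg X → FreeStarAlg X → Prop
  | of {a b : FreeStarAlg X} : r a b → StarClosure r a b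
  | adj {a b : FreeStarAlg X} : r a b → StarClosure r (star a) (star b)

/-- The unital complex `*`-algebra generated by `X` subject to the relations `a = b` for `r a b`:
the quotient of the free `*`-algebra by the two-sided `*`-ideal generated by the relations. -/
def PresStarAlg {X : Type} (r : FreeStarAlg X → FreeStarAlg X → Prop) : Type :=
  RingQuot (StarClosure r)

namespace PresStarAlg

variable {X : Type} {r : FreeStarAlg X → FreeStarAlg X → Prop}

instance : Ring (PresStarAlg r) := inferInstanceAs (Ring (RingQuot (StarClosure r)))
instance : Algebra ℂ (PresStarAlg r) := inferInstanceAs (Algebra ℂ (RingQuot (StarClosure r)))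

variable (r) in
def mkAux : FreeStarAlg X →ₐ[ℂ] PresStarAlg r := RingQuot.mkAlgHom ℂ (StarClosure r)

theorem mkAux_surjective : Function.Surjective (mkAux r) := RingQuot.mkAlgHom_surjective ℂ _

theorem mkAux_rel {a b : FreeStarAlg X} (h : StarClosure r a b) : mkAux r a = mkAux r b :=
  RingQuot.mkAlgHom_rel ℂ h

variable (r) in
def starPre : FreeStarAlg X →ₐ[ℂ] ConjOp (PresStarAlg r) where
  toFun a := MulOpposite.op (mkAux r (star a))
  map_one' := by simp; rfl
  map_mul' a b := by simp; rfl
  map_zero' := by simp; rfl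
  map_add' a b := by simp; rfl
  commutes' c := by rw [FreeStarAlg.star_algebraMap', AlgHom.commutes]; rfl

variable (r) in
def starAux : PresStarAlg r →ₐ[ℂ] ConjOp (PresStarAlg r) :=
  RingQuot.liftAlgHom ℂ ⟨starPre r, by
    rintro a b (h | h)
    · exact congrArg MulOpposite.op (mkAux_rel (StarClosure.adj h))
    · refine congrArg MulOpposite.op ?_
      rw [star_star, star_star]
      exact mkAux_rel (StarClosure.of h)⟩

instance : Star (PresStarAlg r) := ⟨fun a => MulOpposite.unop (starAux r a)⟩

theorem star_mkAux (a : FreeStarAlg X) : star (mkAux r a) = mkAux r (star a) :=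
  congrArg MulOpposite.unop (RingQuot.liftAlgHom_mkAlgHom_apply ℂ (starPre r) _ a)

instance : StarRing (PresStarAlg r) where
  star_involutive a := by
    obtain ⟨a, rfl⟩ := mkAux_surjective a
    rw [star_mkAux, star_mkAux, star_star]
  star_mul a b := by
    obtain ⟨a, rfl⟩ := mkAux_surjective a
    obtain ⟨b, rfl⟩ := mkAux_surjective b
    rw [← map_mul, star_mkAux, star_mul, map_mul, star_mkAux, star_mkAux]
  star_add a b := by
    obtain ⟨a, rfl⟩ := mkAux_surjective a
    obtain ⟨b, rfl⟩ := mkAux_surjective b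
    rw [← map_add, star_mkAux, star_add, map_add, star_mkAux, star_mkAux]

instance : StarModule ℂ (PresStarAlg r) where
  star_smul c a := by
    obtain ⟨a, rfl⟩ := mkAux_surjective a
    rw [← map_smul, star_mkAux, star_smul, map_smul, star_mkAux]

variable (r) in
/-- The quotient map. -/
def mk : FreeStarAlg X →⋆ₐ[ℂ] PresStarAlg r where
  __ := mkAux r
  map_star' a := (star_mkAux a).symm

theorem mk_surjective : Function.Surjective (mk r) := mkAux_surjective

theorem mk_rel {a b : FreeStarAlg X} (h : r a b) : mk r a = mk r b := mkAux_rel (StarClosure.of h)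

variable (r) in
/-- The class of a generator. -/
def gen (x : X) : PresStarAlg r := mk r (FreeStarAlg.gen x)

theorem mk_gen (x : X) : mk r (FreeStarAlg.gen x) = gen r x := rfl

variable {B : Type} [Ring B] [StarRing B] [Algebra ℂ B] [StarModule ℂ B]

def liftAux (g : X → B)
    (h : ∀ a b, r a b → FreeStarAlg.lift g a = FreeStarAlg.lift g b) : PresStarAlg r →ₐ[ℂ] B :=
  RingQuot.liftAlgHom ℂ ⟨(FreeStarAlg.lift g : FreeStarAlg X →ₐ[ℂ] B), by
    rintro a b (h' | h')
    · exact h _ _ h'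
    · change FreeStarAlg.lift g (star _) = FreeStarAlg.lift g (star _)
      rw [map_star, map_star, h _ _ h']⟩

theorem liftAux_mk (g : X → B)
    (h : ∀ a b, r a b → FreeStarAlg.lift g a = FreeStarAlg.lift g b) (a : FreeStarAlg X) :
    liftAux g h (mk r a) = FreeStarAlg.lift g a :=
  RingQuot.liftAlgHom_mkAlgHom_apply ℂ _ _ a

/-- The `*`-homomorphism out of a presented `*`-algebra with given values on the generators, when
these values satisfy the relations. -/
def lift (g : X → B) (h : ∀ a b, r a b → FreeStarAlg.lift g a = FreeStarAlg.lift g b) :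
    PresStarAlg r →⋆ₐ[ℂ] B where
  __ := liftAux g h
  map_star' a := by
    change liftAux g h (star a) = star (liftAux g h a)
    obtain ⟨a, rfl⟩ := mk_surjective a
    rw [← map_star, liftAux_mk, liftAux_mk, map_star]

@[simp] theorem lift_gen (g : X → B)
    (h : ∀ a b, r a b → FreeStarAlg.lift g a = FreeStarAlg.lift g b) (x : X) :
    lift g h (gen r x) = g x :=
  (liftAux_mk g h _).trans (FreeStarAlg.lift_gen g x)

theorem hom_ext {f g : PresStarAlg r →⋆ₐ[ℂ] B} (h : ∀ x, f (gen r x) = g (gen r x)) : f = g := by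
  ext a
  obtain ⟨a, rfl⟩ := mk_surjective a
  induction a using FreeStarAlg.induct with
  | h0 c => simp [AlgHomClass.commutes]
  | h1 y =>
    rcases y with ⟨x, _ | _⟩
    · exact h x
    · have : FreeStarAlg.letter (x, true) = star (FreeStarAlg.gen x) := by
        simp [FreeStarAlg.gen, FreeStarAlg.star_letter]
      rw [this, map_star, map_star, map_star, mk_gen, h x]
  | h2 a b ha hb => simp [ha, hb]
  | h3 a b ha hb => simp [ha, hb]

end PresStarAlg

/-! ### The noncommutative spheres -/

/-- The deformation parameters `exp (2 π i Θ_{ab})`. -/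
def phase {m : ℕ} (Θ : Matrix (Fin m) (Fin m) ℝ) (a b : Fin m) : ℂ :=
  Complex.exp (2 * Real.pi * Complex.I * (Θ a b : ℂ))

open FreeStarAlg in
/-- The commutation relations with parameters `exp (2 π i Θ_{ab})` and the spherical relation
`∑ x_a^* x_a = 1`, for generators `x_a`. -/
inductive SphereRel {m : ℕ} (Θ : Matrix (Fin m) (Fin m) ℝ) :
    FreeStarAlg (Fin m) → FreeStarAlg (Fin m) → Prop
  | comm (a b : Fin m) : SphereRel Θ (gen a * gen b) (phase Θ a b • (gen b * gen a))
  | comm_star (a b : Fin m) :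
      SphereRel Θ (gen a * star (gen b)) (phase Θ b a • (star (gen b) * gen a))
  | star_comm (a b : Fin m) :
      SphereRel Θ (star (gen a) * star (gen b)) (phase Θ a b • (star (gen b) * star (gen a)))
  | sphere : SphereRel Θ (∑ a, star (gen a) * gen a) 1

/-- The deformation matrix of the four-sphere, with rows and columns `0, 1, 2`. -/
def theta4 (θ : ℝ) : Matrix (Fin 3) (Fin 3) ℝ := !![0, 0, 0; 0, 0, θ; 0, -θ, 0]

/-- The deformation matrix `θ'` of the seven-sphere. -/
def theta7 (θ : ℝ) : Matrix (Fin 4) (Fin 4) ℝ :=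
  (θ / 2) • !![0, 0, -1, 1; 0, 0, 1, -1; 1, -1, 0, 0; -1, 1, 0, 0]

/-- The relations of the four-sphere: `SphereRel` for `z_0, z_1, z_2`, and `z_0^* = z_0`. -/
inductive Sphere4Rel (θ : ℝ) : FreeStarAlg (Fin 3) → FreeStarAlg (Fin 3) → Prop
  | of {a b : FreeStarAlg (Fin 3)} : SphereRel (theta4 θ) a b → Sphere4Rel θ a b
  | selfAdj : Sphere4Rel θ (star (FreeStarAlg.gen 0)) (FreeStarAlg.gen 0)

/-- The `*`-algebra `A(S_θ^4)` of polynomial functions on the noncommutative four-sphere. -/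
abbrev A4 (θ : ℝ) : Type := PresStarAlg (Sphere4Rel θ)

/-- The `*`-algebra `A(S_{θ'}^7)` of polynomial functions on the noncommutative seven-sphere. -/
abbrev A7 (θ : ℝ) : Type := PresStarAlg (SphereRel (theta7 θ))

/-- The generators `ψ_1, ψ_2, ψ_3, ψ_4` of `A(S_{θ'}^7)`, numbered from `0`. -/
def psi (θ : ℝ) (a : Fin 4) : A7 θ := PresStarAlg.gen _ a

/-- The `4 × 2` matrix `Ψ` with columns `|ψ_1⟩` and `|ψ_2⟩`. -/
def Psi (θ : ℝ) : Matrix (Fin 4) (Fin 2) (A7 θ) :=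
  !![psi θ 0, -star (psi θ 1);
     psi θ 1, star (psi θ 0);
     psi θ 2, -star (psi θ 3);
     psi θ 3, star (psi θ 2)]

section relations

/-- A generator of the algebra with relations `SphereRel Θ`. -/
def gn {m : ℕ} (Θ : Matrix (Fin m) (Fin m) ℝ) (a : Fin m) : PresStarAlg (SphereRel Θ) :=
  PresStarAlg.gen _ a

variable {m : ℕ} (Θ : Matrix (Fin m) (Fin m) ℝ)

theorem mk_gen' (a : Fin m) : PresStarAlg.mk (SphereRel Θ) (FreeStarAlg.gen a) = gn Θ a := rfl

theorem gen_comm (a b : Fin m) : gn Θ a * gn Θ b = phase Θ a b • (gn Θ b * gn Θ a) := by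
  have h := PresStarAlg.mk_rel (SphereRel.comm (Θ := Θ) a b)
  simpa only [map_mul, map_smul, map_star, mk_gen'] using h

theorem gen_comm_star (a b : Fin m) :
    gn Θ a * star (gn Θ b) = phase Θ b a • (star (gn Θ b) * gn Θ a) := by
  have h := PresStarAlg.mk_rel (SphereRel.comm_star (Θ := Θ) a b)
  simpa only [map_mul, map_smul, map_star, mk_gen'] using h

theorem gen_star_comm (a b : Fin m) :
    star (gn Θ a) * star (gn Θ b) = phase Θ a b • (star (gn Θ b) * star (gn Θ a)) := by
  have h := PresStarAlg.mk_rel (SphereRel.star_comm (Θ := Θ) a b)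
  simpa only [map_mul, map_smul, map_star, mk_gen'] using h

theorem gen_sphere : ∑ a, star (gn Θ a) * gn Θ a = 1 := by
  have h := PresStarAlg.mk_rel (SphereRel.sphere (Θ := Θ))
  simpa only [map_mul, map_sum, map_star, mk_gen', map_one] using h

end relations

theorem phase_mul_neg {m : ℕ} (Θ : Matrix (Fin m) (Fin m) ℝ) {a b c d : Fin m}
    (h : Θ c d = -Θ a b) : phase Θ a b * phase Θ c d = 1 := by
  rw [phase, phase, ← Complex.exp_add, h]
  push_cast
  rw [← Complex.exp_zero]
  congr 1
  ring

theorem phase_congr {m : ℕ} (Θ : Matrix (Fin m) (Fin m) ℝ) {a b c d : Fin m}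
    (h : Θ c d = Θ a b) : phase Θ c d = phase Θ a b := by
  rw [phase, phase, h]

section seven

variable (θ : ℝ)

theorem psi_comm {c d : Fin 4} (a b : Fin 4) (h : theta7 θ c d = theta7 θ a b) :
    psi θ a * psi θ b = phase (theta7 θ) c d • (psi θ b * psi θ a) := by
  rw [phase_congr _ h]; exact gen_comm _ a b

theorem psi_comm_star {c d : Fin 4} (a b : Fin 4) (h : theta7 θ c d = theta7 θ b a) :
    psi θ a * star (psi θ b) = phase (theta7 θ) c d • (star (psi θ b) * psi θ a) := by
  rw [phase_congr _ h]; exact gen_comm_star _ a b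

theorem psi_star_comm {c d : Fin 4} (a b : Fin 4) (h : theta7 θ c d = theta7 θ a b) :
    star (psi θ a) * star (psi θ b) = phase (theta7 θ) c d • (star (psi θ b) * star (psi θ a)) := by
  rw [phase_congr _ h]; exact gen_star_comm _ a b

theorem psi_star_comm' {c d : Fin 4} (a b : Fin 4) (h : theta7 θ c d = -theta7 θ a b) :
    star (psi θ a) * psi θ b = phase (theta7 θ) c d • (psi θ b * star (psi θ a)) := by
  have h2 : psi θ b * star (psi θ a) = _ := gen_comm_star (theta7 θ) b a
  rw [h2, smul_smul, mul_comm, phase_mul_neg _ h, one_smul]; rfl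

theorem Psi_comm (a b : Fin 4) (i j : Fin 2) :
    Psi θ a i * Psi θ b j = phase (theta7 θ) a b • (Psi θ b j * Psi θ a i) := by
  fin_cases a <;> fin_cases b <;> fin_cases i <;> fin_cases j <;>
    simp only [Psi, Matrix.of_apply, Matrix.cons_val, Fin.zero_eta, Fin.mk_one, Fin.reduceFinMk,
      Fin.isValue, neg_mul, mul_neg, neg_neg, smul_neg, neg_inj] <;>
    first
    | (apply psi_comm; simp [theta7])
    | (apply psi_comm_star; simp [theta7])
    | (apply psi_star_comm; simp [theta7])
    | (apply psi_star_comm'; simp [theta7])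

theorem Psi_comm_star (a b : Fin 4) (i j : Fin 2) :
    Psi θ a i * star (Psi θ b j) = phase (theta7 θ) b a • (star (Psi θ b j) * Psi θ a i) := by
  fin_cases a <;> fin_cases b <;> fin_cases i <;> fin_cases j <;>
    simp only [Psi, Matrix.of_apply, Matrix.cons_val, Fin.zero_eta, Fin.mk_one, Fin.reduceFinMk,
      Fin.isValue, neg_mul, mul_neg, neg_neg, smul_neg, neg_inj, star_neg, star_star] <;>
    first
    | (apply psi_comm; simp [theta7])
    | (apply psi_comm_star; simp [theta7])
    | (apply psi_star_comm; simp [theta7])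
    | (apply psi_star_comm'; simp [theta7])

theorem Psi_star_mul (i j : Fin 2) :
    ∑ a, star (Psi θ a i) * Psi θ a j = if i = j then 1 else 0 := by
  have hs : ∑ a, star (psi θ a) * psi θ a = 1 := gen_sphere (theta7 θ)
  have hn (a : Fin 4) : psi θ a * star (psi θ a) = star (psi θ a) * psi θ a := by
    have := psi_comm_star θ (c := a) (d := a) a a rfl
    rwa [show phase (theta7 θ) a a = 1 by fin_cases a <;> simp [phase, theta7], one_smul] at this
  have hp : phase (theta7 θ) 0 1 = 1 ∧ phase (theta7 θ) 2 3 = 1 := by simp [phase, theta7]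
  have h01 : psi θ 0 * psi θ 1 = psi θ 1 * psi θ 0 := by
    have := psi_comm θ (c := 0) (d := 1) 0 1 rfl
    rwa [hp.1, one_smul] at this
  have h23 : psi θ 2 * psi θ 3 = psi θ 3 * psi θ 2 := by
    have := psi_comm θ (c := 2) (d := 3) 2 3 rfl
    rwa [hp.2, one_smul] at this
  have h01s : star (psi θ 0) * star (psi θ 1) = star (psi θ 1) * star (psi θ 0) := by
    rw [← star_mul, ← star_mul, h01]
  have h23s : star (psi θ 2) * star (psi θ 3) = star (psi θ 3) * star (psi θ 2) := by
    rw [← star_mul, ← star_mul, h23]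
  rw [Fin.sum_univ_four] at hs ⊢
  fin_cases i <;> fin_cases j <;> simp [Psi]
  · exact hs
  · rw [h01s, h23s]; abel
  · rw [h01, h23]; abel
  · rw [hn, hn, hn, hn, ← hs]; abel

end seven

/-! ### The action of `SU(2)` on `A(S_{θ'}^7)` -/

/-- The group `SU(2)`. -/
abbrev SU2 : Type := Matrix.specialUnitaryGroup (Fin 2) ℂ

theorem SU2_apply (w : SU2) :
    star ((w : Matrix (Fin 2) (Fin 2) ℂ) 0 0) = (w : Matrix (Fin 2) (Fin 2) ℂ) 1 1 ∧
    star ((w : Matrix (Fin 2) (Fin 2) ℂ) 1 0) = -(w : Matrix (Fin 2) (Fin 2) ℂ) 0 1 := by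
  obtain ⟨w, hw⟩ := w
  obtain ⟨hu, hd⟩ := Matrix.mem_specialUnitaryGroup_iff.1 hw
  have h1 := Matrix.mem_unitaryGroup_iff'.1 hu
  have h2 : star w = w.adjugate := by
    have h3 : w * w.adjugate = 1 := by rw [Matrix.mul_adjugate, hd, one_smul]
    calc star w = star w * (w * w.adjugate) := by rw [h3, mul_one]
      _ = w.adjugate := by rw [← mul_assoc, h1, one_mul]
  rw [Matrix.adjugate_fin_two] at h2
  exact ⟨by simpa using congrFun (congrFun h2 0) 0, by simpa using congrFun (congrFun h2 0) 1⟩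

theorem SU2_unitary (w : SU2) (i j : Fin 2) :
    ∑ k, star ((w : Matrix (Fin 2) (Fin 2) ℂ) k i) * (w : Matrix (Fin 2) (Fin 2) ℂ) k j =
      if i = j then 1 else 0 := by
  have h1 := Matrix.mem_unitaryGroup_iff'.1 (Matrix.mem_specialUnitaryGroup_iff.1 w.2).1
  simpa [Matrix.mul_apply, Matrix.one_apply] using congrFun (congrFun h1 i) j

/-- The entries of the matrix product `Ψ w`. -/
def PsiMul (θ : ℝ) (w : SU2) (a : Fin 4) (i : Fin 2) : A7 θ :=
  ∑ j, (w : Matrix (Fin 2) (Fin 2) ℂ) j i • Psi θ a j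

theorem PsiMul_comm (θ : ℝ) (w : SU2) (a b : Fin 4) (i j : Fin 2) :
    PsiMul θ w a i * PsiMul θ w b j =
      phase (theta7 θ) a b • (PsiMul θ w b j * PsiMul θ w a i) := by
  simp only [PsiMul, Finset.sum_mul, Finset.mul_sum, Finset.smul_sum]
  rw [Finset.sum_comm]
  refine Finset.sum_congr rfl fun k _ => Finset.sum_congr rfl fun l _ => ?_
  simp only [smul_mul_assoc, mul_smul_comm]
  rw [Psi_comm]
  module

theorem PsiMul_comm_star (θ : ℝ) (w : SU2) (a b : Fin 4) (i j : Fin 2) :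
    PsiMul θ w a i * star (PsiMul θ w b j) =
      phase (theta7 θ) b a • (star (PsiMul θ w b j) * PsiMul θ w a i) := by
  simp only [PsiMul, star_sum, Finset.sum_mul, Finset.mul_sum, Finset.smul_sum]
  rw [Finset.sum_comm]
  refine Finset.sum_congr rfl fun k _ => Finset.sum_congr rfl fun l _ => ?_
  simp only [star_smul, smul_mul_assoc, mul_smul_comm]
  rw [Psi_comm_star]
  module

theorem star_phase {m : ℕ} (Θ : Matrix (Fin m) (Fin m) ℝ) {a b c d : Fin m}
    (h : Θ c d = -Θ a b) : star (phase Θ a b) = phase Θ c d := by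
  rw [phase, phase, h, Complex.star_def, ← Complex.exp_conj]
  congr 1
  simp [Complex.conj_ofReal, Complex.conj_ofNat]

theorem PsiMul_sphere (θ : ℝ) (w : SU2) (i : Fin 2) :
    ∑ a, star (PsiMul θ w a i) * PsiMul θ w a i = 1 := by
  have h : ∀ a, star (PsiMul θ w a i) * PsiMul θ w a i =
      ∑ k, ∑ l, (star ((w : Matrix (Fin 2) (Fin 2) ℂ) k i) * (w : Matrix (Fin 2) (Fin 2) ℂ) l i) •
        (star (Psi θ a k) * Psi θ a l) := by
    intro a
    simp only [PsiMul, star_sum, Finset.sum_mul, Finset.mul_sum]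
    refine (Finset.sum_comm).trans
      (Finset.sum_congr rfl fun k _ => Finset.sum_congr rfl fun l _ => ?_)
    simp only [star_smul, smul_mul_assoc, mul_smul_comm, smul_smul]
    congr 1
    ring
  have hw := SU2_unitary w i i
  simp only [if_true] at hw
  simp only [h]
  rw [Finset.sum_comm]
  calc _ = ∑ k, ∑ l, (star ((w : Matrix (Fin 2) (Fin 2) ℂ) k i) *
        (w : Matrix (Fin 2) (Fin 2) ℂ) l i) • ∑ a, star (Psi θ a k) * Psi θ a l := by
        refine Finset.sum_congr rfl fun k _ => ?_
        rw [Finset.sum_comm]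
        simp only [Finset.smul_sum]
    _ = 1 := by
        simp only [Psi_star_mul, smul_ite, smul_zero, Finset.sum_ite_eq, Finset.mem_univ, if_true]
        rw [← Finset.sum_smul, hw, one_smul]

/-- The `*`-homomorphism `α_w` of `A(S_{θ'}^7)`: it sends the first column `ψ` of `Ψ` to the first
column of `Ψ w`. By `alpha_Psi`, all of `Ψ` is sent to `Ψ w`. -/
def alpha (θ : ℝ) (w : SU2) : A7 θ →⋆ₐ[ℂ] A7 θ :=
  PresStarAlg.lift (fun a => PsiMul θ w a 0) (by
    intro x y h
    cases h with
    | comm a b => simpa using PsiMul_comm θ w a b 0 0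
    | comm_star a b => simpa using PsiMul_comm_star θ w a b 0 0
    | star_comm a b =>
      have := congrArg star (PsiMul_comm θ w b a 0 0)
      rw [star_smul, star_phase (theta7 θ) (c := a) (d := b)
        (by fin_cases a <;> fin_cases b <;> simp [theta7])] at this
      simpa using this
    | sphere => simpa using PsiMul_sphere θ w 0)

theorem alpha_psi (θ : ℝ) (w : SU2) (a : Fin 4) : alpha θ w (psi θ a) = PsiMul θ w a 0 :=
  PresStarAlg.lift_gen _ _ a

theorem alpha_star_psi (θ : ℝ) (w : SU2) (a : Fin 4) :
    alpha θ w (star (psi θ a)) = star (PsiMul θ w a 0) := by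
  rw [map_star, alpha_psi]

/-- `α_w(Ψ) = Ψ w`. -/
theorem alpha_Psi (θ : ℝ) (w : SU2) (a : Fin 4) (i : Fin 2) :
    alpha θ w (Psi θ a i) = ∑ j, (w : Matrix (Fin 2) (Fin 2) ℂ) j i • Psi θ a j := by
  obtain ⟨h1, h2⟩ := SU2_apply w
  fin_cases a <;> fin_cases i <;>
    simp [Psi, alpha_psi, alpha_star_psi, PsiMul, h1, h2, -RCLike.star_def, -Complex.star_def] <;> abel

/-! ### The Hopf fibration -/

/-- The elements `z_0, z_1, z_2` of `A(S_{θ'}^7)`. -/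
def hopfZ (θ : ℝ) : Fin 3 → A7 θ :=
  ![star (psi θ 0) * psi θ 0 + star (psi θ 1) * psi θ 1
      - star (psi θ 2) * psi θ 2 - star (psi θ 3) * psi θ 3,
    2 * (psi θ 0 * star (psi θ 2) + star (psi θ 1) * psi θ 3),
    2 * (-(star (psi θ 0) * psi θ 3) + psi θ 1 * star (psi θ 2))]

section hopf

variable (θ : ℝ)

def bracket (a b : Fin 4) : A7 θ := Psi θ a 0 * Psi θ b 1 - Psi θ a 1 * Psi θ b 0

theorem psi_normal (a : Fin 4) : psi θ a * star (psi θ a) = star (psi θ a) * psi θ a := by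
  have := psi_comm_star θ (c := a) (d := a) a a rfl
  rwa [show phase (theta7 θ) a a = 1 by fin_cases a <;> simp [phase, theta7], one_smul] at this

theorem hopfZ_zero : hopfZ θ 0 = bracket θ 0 1 - bracket θ 2 3 := by
  simp [hopfZ, bracket, Psi, psi_normal]
  abel

theorem hopfZ_one : hopfZ θ 1 = (2 : ℂ) • bracket θ 0 3 := by
  simp [hopfZ, bracket, Psi, two_smul, two_mul]
  abel

theorem hopfZ_two : hopfZ θ 2 = (2 : ℂ) • bracket θ 1 3 := by
  simp [hopfZ, bracket, Psi, two_smul, two_mul]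
  abel

theorem alpha_bracket (w : SU2) (a b : Fin 4) : alpha θ w (bracket θ a b) = bracket θ a b := by
  have hd : (w : Matrix (Fin 2) (Fin 2) ℂ).det = 1 := (Matrix.mem_specialUnitaryGroup_iff.1 w.2).2
  rw [Matrix.det_fin_two] at hd
  have key : alpha θ w (bracket θ a b) =
      ((w : Matrix (Fin 2) (Fin 2) ℂ) 0 0 * (w : Matrix (Fin 2) (Fin 2) ℂ) 1 1 -
        (w : Matrix (Fin 2) (Fin 2) ℂ) 0 1 * (w : Matrix (Fin 2) (Fin 2) ℂ) 1 0) •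
        bracket θ a b := by
    simp only [bracket, map_sub, map_mul, alpha_Psi, Fin.sum_univ_two, mul_add, add_mul,
      smul_mul_assoc, mul_smul_comm]
    module
  rw [key, hd, one_smul]

theorem alpha_hopfZ (w : SU2) (μ : Fin 3) : alpha θ w (hopfZ θ μ) = hopfZ θ μ := by
  fin_cases μ
  · change alpha θ w (hopfZ θ 0) = hopfZ θ 0
    rw [hopfZ_zero, map_sub, alpha_bracket, alpha_bracket]
  · change alpha θ w (hopfZ θ 1) = hopfZ θ 1
    rw [hopfZ_one, map_smul, alpha_bracket]
  · change alpha θ w (hopfZ θ 2) = hopfZ θ 2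
    rw [hopfZ_two, map_smul, alpha_bracket]

/-- Commutation up to a phase `exp (2 π i t)`. -/
def QC (t : ℝ) (x y : A7 θ) : Prop :=
  x * y = Complex.exp (2 * Real.pi * Complex.I * (t : ℂ)) • (y * x)

variable {θ}

theorem exp_split (s t : ℝ) : Complex.exp (2 * Real.pi * Complex.I * ((s + t : ℝ) : ℂ)) =
    Complex.exp (2 * Real.pi * Complex.I * (s : ℂ)) *
      Complex.exp (2 * Real.pi * Complex.I * (t : ℂ)) := by
  rw [← Complex.exp_add]
  congr 1
  push_cast
  ring

theorem QC.mul_left {s t : ℝ} {x x' y : A7 θ} (h : QC θ s x y) (h' : QC θ t x' y) :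
    QC θ (s + t) (x * x') y := by
  unfold QC at *
  rw [exp_split, mul_assoc, h', mul_smul_comm, ← mul_assoc, h, smul_mul_assoc, smul_smul,
    mul_comm (Complex.exp _), mul_assoc y]

theorem QC.mul_right {s t : ℝ} {x y y' : A7 θ} (h : QC θ s x y) (h' : QC θ t x y') :
    QC θ (s + t) x (y * y') := by
  unfold QC at *
  rw [exp_split, ← mul_assoc, h, smul_mul_assoc, mul_assoc y, h', mul_smul_comm, smul_smul,
    mul_assoc y]

theorem QC.sub_left {s : ℝ} {x x' y : A7 θ} (h : QC θ s x y) (h' : QC θ s x' y) :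
    QC θ s (x - x') y := by
  unfold QC at *
  rw [sub_mul, h, h', mul_sub, smul_sub]

theorem QC.sub_right {s : ℝ} {x y y' : A7 θ} (h : QC θ s x y) (h' : QC θ s x y') :
    QC θ s x (y - y') := by
  unfold QC at *
  rw [mul_sub, h, h', sub_mul, smul_sub]

theorem QC.smul_left {s : ℝ} {x y : A7 θ} (h : QC θ s x y) (c : ℂ) : QC θ s (c • x) y := by
  unfold QC at *
  rw [smul_mul_assoc, h, mul_smul_comm, smul_comm]

theorem QC.smul_right {s : ℝ} {x y : A7 θ} (h : QC θ s x y) (c : ℂ) : QC θ s x (c • y) := by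
  unfold QC at *
  rw [mul_smul_comm, h, smul_mul_assoc, smul_comm]

theorem QC.congr {s t : ℝ} {x y : A7 θ} (h : QC θ s x y) (e : s = t) : QC θ t x y := e ▸ h

variable (θ)

theorem bracket_comm (a b c d : Fin 4) :
    QC θ (theta7 θ a c + theta7 θ b c + (theta7 θ a d + theta7 θ b d))
      (bracket θ a b) (bracket θ c d) := by
  have P (a b : Fin 4) (i j : Fin 2) : QC θ (theta7 θ a b) (Psi θ a i) (Psi θ b j) :=
    Psi_comm θ a b i j
  have M (i j k l : Fin 2) : QC θ (theta7 θ a c + theta7 θ b c + (theta7 θ a d + theta7 θ b d))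
      (Psi θ a i * Psi θ b j) (Psi θ c k * Psi θ d l) :=
    ((P a c i k).mul_left (P b c j k)).mul_right ((P a d i l).mul_left (P b d j l))
  exact ((M _ _ _ _).sub_left (M _ _ _ _)).sub_right ((M _ _ _ _).sub_left (M _ _ _ _))

theorem bracket_comm_star (a b c d : Fin 4) :
    QC θ (theta7 θ c a + theta7 θ c b + (theta7 θ d a + theta7 θ d b))
      (bracket θ a b) (star (bracket θ c d)) := by
  have P (a b : Fin 4) (i j : Fin 2) : QC θ (theta7 θ b a) (Psi θ a i) (star (Psi θ b j)) :=
    Psi_comm_star θ a b i j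
  have M (i j k l : Fin 2) : QC θ (theta7 θ c a + theta7 θ c b + (theta7 θ d a + theta7 θ d b))
      (Psi θ a i * Psi θ b j) (star (Psi θ c k * Psi θ d l)) := by
    rw [star_mul, add_comm]
    exact ((P a d i l).mul_left (P b d j l)).mul_right ((P a c i k).mul_left (P b c j k))
  unfold bracket
  rw [star_sub]
  exact ((M _ _ _ _).sub_left (M _ _ _ _)).sub_right ((M _ _ _ _).sub_left (M _ _ _ _))

theorem hopfZ_comm (μ ν : Fin 3) : QC θ (theta4 θ μ ν) (hopfZ θ μ) (hopfZ θ ν) := by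
  have E (a b c d : Fin 4) (t : ℝ)
      (h : theta7 θ a c + theta7 θ b c + (theta7 θ a d + theta7 θ b d) = t) :
      QC θ t (bracket θ a b) (bracket θ c d) := (bracket_comm θ a b c d).congr h
  fin_cases μ <;> fin_cases ν <;>
    simp only [Fin.zero_eta, Fin.mk_one, Fin.reduceFinMk, Fin.isValue, hopfZ_zero, hopfZ_one,
      hopfZ_two] <;>
    repeat' (first | with_reducible apply E | with_reducible apply QC.smul_left |
      with_reducible apply QC.smul_right | with_reducible apply QC.sub_left |
      with_reducible apply QC.sub_right)
  all_goals simp [theta7, theta4]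
  all_goals ring

theorem hopfZ_comm_star (μ ν : Fin 3) :
    QC θ (theta4 θ ν μ) (hopfZ θ μ) (star (hopfZ θ ν)) := by
  have E (a b c d : Fin 4) (t : ℝ)
      (h : theta7 θ c a + theta7 θ c b + (theta7 θ d a + theta7 θ d b) = t) :
      QC θ t (bracket θ a b) (star (bracket θ c d)) := (bracket_comm_star θ a b c d).congr h
  fin_cases μ <;> fin_cases ν <;>
    simp only [Fin.zero_eta, Fin.mk_one, Fin.reduceFinMk, Fin.isValue, hopfZ_zero, hopfZ_one,
      hopfZ_two, star_smul, star_sub] <;>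
    repeat' (first | with_reducible apply E | with_reducible apply QC.smul_left |
      with_reducible apply QC.smul_right | with_reducible apply QC.sub_left |
      with_reducible apply QC.sub_right)
  all_goals simp [theta7, theta4]
  all_goals ring

theorem hopfZ_selfAdj : star (hopfZ θ 0) = hopfZ θ 0 := by
  simp [hopfZ]

/-- The entries of `Ψ Ψ^*`. -/
def projP (a b : Fin 4) : A7 θ := ∑ i, Psi θ a i * star (Psi θ b i)

theorem projP_sq (a c : Fin 4) : ∑ b, projP θ a b * projP θ b c = projP θ a c := by
  have h (b : Fin 4) : projP θ a b * projP θ b c =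
      ∑ i, ∑ j, Psi θ a i * (star (Psi θ b i) * Psi θ b j) * star (Psi θ c j) := by
    simp only [projP, Finset.sum_mul, Finset.mul_sum, mul_assoc]
    rw [Finset.sum_comm]
  simp only [h]
  rw [Finset.sum_comm]
  calc _ = ∑ i, ∑ j, Psi θ a i * (∑ b, star (Psi θ b i) * Psi θ b j) * star (Psi θ c j) := by
        refine Finset.sum_congr rfl fun k _ => ?_
        rw [Finset.sum_comm]
        simp only [Finset.sum_mul, Finset.mul_sum]
    _ = projP θ a c := by simp [Psi_star_mul, projP]

theorem hopfZ_sphere : ∑ μ, star (hopfZ θ μ) * hopfZ θ μ = 1 := by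
  have hs : ∑ a, star (psi θ a) * psi θ a = 1 := gen_sphere (theta7 θ)
  rw [Fin.sum_univ_four] at hs
  have h00 : (2 : ℂ) • projP θ 0 0 = 1 + hopfZ θ 0 := by
    rw [← hs]
    simp [projP, Psi, hopfZ, psi_normal, two_smul]
    abel
  have hc : psi θ 0 * star (psi θ 1) = star (psi θ 1) * psi θ 0 := by
    have := psi_comm_star θ (c := 1) (d := 0) 0 1 rfl
    rwa [show phase (theta7 θ) 1 0 = 1 by simp [phase, theta7], one_smul] at this
  have h01 : projP θ 0 1 = 0 := by
    simp [projP, Psi, hc]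
  have hst (a b : Fin 4) : projP θ b a = star (projP θ a b) := by simp [projP]
  have h02 : (2 : ℂ) • projP θ 0 2 = hopfZ θ 1 := by
    simp [projP, Psi, hopfZ, two_smul, two_mul]
    abel
  have h03 : (2 : ℂ) • projP θ 0 3 = -(phase (theta7 θ) 3 0 • star (hopfZ θ 2)) := by
    have e1 : psi θ 0 * star (psi θ 3) = phase (theta7 θ) 3 0 • (star (psi θ 3) * psi θ 0) :=
      gen_comm_star (theta7 θ) 0 3
    have e2 : star (psi θ 1) * psi θ 2 = phase (theta7 θ) 3 0 • (psi θ 2 * star (psi θ 1)) :=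
      psi_star_comm' θ 1 2 (by simp [theta7])
    simp [projP, Psi, hopfZ, two_smul, two_mul, e1, e2]
    module
  have hq : phase (theta7 θ) 3 0 * star (phase (theta7 θ) 3 0) = 1 := by
    rw [star_phase (theta7 θ) (c := 0) (d := 3) (by simp [theta7])]
    exact phase_mul_neg _ (by simp [theta7])
  have hcomm (μ : Fin 3) : hopfZ θ μ * star (hopfZ θ μ) = star (hopfZ θ μ) * hopfZ θ μ := by
    have := hopfZ_comm_star θ μ μ
    unfold QC at this
    rwa [show theta4 θ μ μ = 0 by fin_cases μ <;> simp [theta4], Complex.ofReal_zero, mul_zero,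
      Complex.exp_zero, one_smul] at this
  have hp := projP_sq θ 0 0
  rw [Fin.sum_univ_four, hst 0 1, hst 0 2, hst 0 3, h01, zero_mul, add_zero] at hp
  have h4 : ((2 : ℂ) • projP θ 0 0) * ((2 : ℂ) • projP θ 0 0) +
      ((2 : ℂ) • projP θ 0 2) * star ((2 : ℂ) • projP θ 0 2) +
      ((2 : ℂ) • projP θ 0 3) * star ((2 : ℂ) • projP θ 0 3) =
      (2 : ℂ) • (2 : ℂ) • projP θ 0 0 := by
    conv_rhs => rw [← hp]
    simp only [star_smul, smul_mul_assoc, mul_smul_comm, smul_add, star_ofNat]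
  rw [h00, h02, h03, star_neg, neg_mul_neg, star_smul, star_star, smul_mul_assoc, mul_smul_comm,
    smul_smul, hq, one_smul, hcomm] at h4
  rw [Fin.sum_univ_three, hopfZ_selfAdj]
  have h5 : hopfZ θ 0 * hopfZ θ 0 + star (hopfZ θ 1) * hopfZ θ 1 + star (hopfZ θ 2) * hopfZ θ 2
      = ((1 + hopfZ θ 0) * (1 + hopfZ θ 0) + star (hopfZ θ 1) * hopfZ θ 1 +
        star (hopfZ θ 2) * hopfZ θ 2) - (2 : ℂ) • (1 + hopfZ θ 0) + 1 := by
    rw [two_smul]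
    noncomm_ring
  rw [h5, h4, sub_self, zero_add]

/-- The `*`-homomorphism `A(S_θ^4) → A(S_{θ'}^7)` of the Hopf fibration. -/
def hopf : A4 θ →⋆ₐ[ℂ] A7 θ :=
  PresStarAlg.lift (hopfZ θ) (by
    intro x y h
    cases h with
    | of h =>
      cases h with
      | comm a b =>
        have : _ = phase (theta4 θ) a b • _ := hopfZ_comm θ a b
        simpa using this
      | comm_star a b =>
        have : _ = phase (theta4 θ) b a • _ := hopfZ_comm_star θ a b
        simpa using this
      | star_comm a b =>
        have := congrArg star (hopfZ_comm θ b a)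
        change star (_ * _) = star (phase (theta4 θ) b a • _) at this
        rw [star_smul, star_phase (theta4 θ) (c := a) (d := b)
          (by fin_cases a <;> fin_cases b <;> simp [theta4])] at this
        simpa using this
      | sphere => simpa using hopfZ_sphere θ
    | selfAdj => simpa using hopfZ_selfAdj θ)

theorem hopf_gen (μ : Fin 3) : hopf θ (PresStarAlg.gen _ μ) = hopfZ θ μ :=
  PresStarAlg.lift_gen _ _ μ

theorem alpha_hopf (w : SU2) (f : A4 θ) : alpha θ w (hopf θ f) = hopf θ f := by
  have h : (alpha θ w).comp (hopf θ) = hopf θ := PresStarAlg.hom_ext fun μ => by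
    rw [StarAlgHom.comp_apply, hopf_gen, alpha_hopfZ]
  exact DFunLike.congr_fun h f

end hopf

/-- `A(S_{θ'}^7)` is a right `A(S_θ^4)`-module through the Hopf fibration: `a · f = a * hopf f`. -/
instance (θ : ℝ) : Module (A4 θ)ᵐᵒᵖ (A7 θ) :=
  Module.compHom (A7 θ) ((hopf θ : A4 θ →+* A7 θ).op)

theorem op_smul_def (θ : ℝ) (f : A4 θ) (a : A7 θ) : MulOpposite.op f • a = a * hopf θ f := rfl

instance (θ : ℝ) : SMulCommClass ℂ (A4 θ)ᵐᵒᵖ (A7 θ) where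
  smul_comm c f a := by
    obtain ⟨f, rfl⟩ := MulOpposite.op_surjective f
    rw [op_smul_def, op_smul_def, smul_mul_assoc]

instance (θ : ℝ) : SMulCommClass (A4 θ)ᵐᵒᵖ ℂ (A7 θ) := SMulCommClass.symm _ _ _

/-! ### The representations of `SU(2)` -/

/-- `W^{(n)} = Sym^n(ℂ²)`, as the space of symmetric tensors in `(ℂ²)^{⊗ n}`; a tensor is given by
its coordinates with respect to the basis `e_{i_1} ⊗ ⋯ ⊗ e_{i_n}`, for `i : Fin n → Fin 2`. -/
def SymPow (n : ℕ) : Submodule ℂ ((Fin n → Fin 2) → ℂ) where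
  carrier := {v | ∀ (σ : Equiv.Perm (Fin n)) (i : Fin n → Fin 2), v (i ∘ σ) = v i}
  add_mem' hu hv σ i := by simp [hu σ i, hv σ i]
  zero_mem' _ _ := rfl
  smul_mem' c v hv σ i := by simp [hv σ i]

/-- The operator `w ⊗ ⋯ ⊗ w` on `(ℂ²)^{⊗ n}`. -/
def tensorOp (n : ℕ) (w : Matrix (Fin 2) (Fin 2) ℂ) :
    ((Fin n → Fin 2) → ℂ) →ₗ[ℂ] ((Fin n → Fin 2) → ℂ) :=
  Matrix.toLin' (Matrix.of fun i j => ∏ t, w (i t) (j t))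

theorem tensorOp_apply (n : ℕ) (w : Matrix (Fin 2) (Fin 2) ℂ) (v : (Fin n → Fin 2) → ℂ)
    (i : Fin n → Fin 2) : tensorOp n w v i = ∑ j, (∏ t, w (i t) (j t)) * v j := by
  simp [tensorOp, Matrix.mulVec, dotProduct]

theorem tensorOp_mem (n : ℕ) (w : Matrix (Fin 2) (Fin 2) ℂ) {v : (Fin n → Fin 2) → ℂ}
    (hv : v ∈ SymPow n) : tensorOp n w v ∈ SymPow n := by
  intro σ i
  rw [tensorOp_apply, tensorOp_apply]
  refine (Fintype.sum_equiv (Equiv.arrowCongr σ.symm (Equiv.refl (Fin 2))) _ _ fun j => ?_).symm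
  have h1 : (Equiv.arrowCongr σ.symm (Equiv.refl (Fin 2))) j = j ∘ σ := rfl
  rw [h1, hv σ j]
  congr 1
  exact (Equiv.prod_comp σ fun t => w (i t) (j t)).symm

/-- The representation `ρ_{(n)}` of `SU(2)` on `Sym^n(ℂ²)`, the `n`-th symmetric power of the
defining representation. -/
def rho (n : ℕ) : Representation ℂ SU2 (SymPow n) where
  toFun w := (tensorOp n (w : Matrix (Fin 2) (Fin 2) ℂ)).restrict fun _ hv => tensorOp_mem n _ hv
  map_one' := by
    ext v i
    have : (Matrix.of fun i j : Fin n → Fin 2 => ∏ t, (1 : Matrix (Fin 2) (Fin 2) ℂ) (i t) (j t))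
        = 1 := by
      ext i j
      simp only [Matrix.of_apply, Matrix.one_apply, Finset.prod_ite_zero, Finset.prod_const_one,
        Finset.mem_univ, true_imp_iff, funext_iff]
    simp [LinearMap.restrict_apply, tensorOp, this]
  map_mul' w w' := by
    ext v i
    have : (Matrix.of fun i j : Fin n → Fin 2 => ∏ t, ((w : Matrix (Fin 2) (Fin 2) ℂ) *
          (w' : Matrix (Fin 2) (Fin 2) ℂ)) (i t) (j t)) =
        (Matrix.of fun i j : Fin n → Fin 2 => ∏ t, (w : Matrix (Fin 2) (Fin 2) ℂ) (i t) (j t)) *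
        (Matrix.of fun i j : Fin n → Fin 2 => ∏ t, (w' : Matrix (Fin 2) (Fin 2) ℂ) (i t) (j t)) := by
      ext i j
      simp only [Matrix.of_apply, Matrix.mul_apply, ← Finset.prod_mul_distrib]
      exact Finset.prod_univ_sum _ _
    simp [LinearMap.restrict_apply, tensorOp, this]

/-- The arrangements of `n - k` symbols `0` and `k` symbols `1`. -/
def arrangements (n k : ℕ) : Finset (Fin n → Fin 2) :=
  Finset.univ.filter fun i => (Finset.univ.filter fun t => i t = 1).card = k

/-- The orthonormal basis vectors of `Sym^n(ℂ²)`, numbered from `k = 0`: the sum of the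
`n.choose k` tensor products of `n - k` factors `e_1` and `k` factors `e_2`, divided by
`√(n.choose k)`. -/
def symBasis (n : ℕ) (k : Fin (n + 1)) : SymPow n :=
  ⟨fun i => if i ∈ arrangements n k then ((Real.sqrt (n.choose k) : ℝ) : ℂ)⁻¹ else 0, by
    intro σ i
    have h : (Finset.univ.filter fun t => (i ∘ σ) t = 1).card =
        (Finset.univ.filter fun t => i t = 1).card :=
      Finset.card_bij' (fun t _ => σ t) (fun t _ => σ.symm t) (by simp) (by simp) (by simp)
        (by simp)
    simp only [arrangements, Finset.mem_filter, Finset.mem_univ, true_and, h]⟩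

/-! ### Equivariant maps and the projections -/

/-- The right `A(S_θ^4)`-module `A(S_{θ'}^7) ⊠_{ρ_{(n)}} W^{(n)}` of equivariant maps. -/
def Equivariant (θ : ℝ) (n : ℕ) : Submodule (A4 θ)ᵐᵒᵖ (A7 θ ⊗[ℂ] SymPow n) where
  carrier := {φ | ∀ w : SU2,
    TensorProduct.map ((alpha θ w : A7 θ →ₐ[ℂ] A7 θ).toLinearMap) LinearMap.id φ =
      TensorProduct.map LinearMap.id (rho n w⁻¹) φ}
  add_mem' hu hv w := by rw [map_add, map_add, hu w, hv w]
  zero_mem' w := by rw [map_zero, map_zero]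
  smul_mem' f φ hφ w := by
    obtain ⟨f, rfl⟩ := MulOpposite.op_surjective f
    have h1 (x : A7 θ ⊗[ℂ] SymPow n) :
        TensorProduct.map ((alpha θ w : A7 θ →ₐ[ℂ] A7 θ).toLinearMap) LinearMap.id
          (MulOpposite.op f • x) = MulOpposite.op f •
        TensorProduct.map ((alpha θ w : A7 θ →ₐ[ℂ] A7 θ).toLinearMap) LinearMap.id x := by
      induction x with
      | zero => simp
      | add x y hx hy => rw [smul_add, map_add, hx, hy, map_add, smul_add]
      | tmul a v =>
        rw [TensorProduct.smul_tmul', TensorProduct.map_tmul, TensorProduct.map_tmul,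
          TensorProduct.smul_tmul', op_smul_def, op_smul_def]
        congr 1
        change alpha θ w (a * hopf θ f) = alpha θ w a * hopf θ f
        rw [map_mul, alpha_hopf]
    have h2 (x : A7 θ ⊗[ℂ] SymPow n) :
        TensorProduct.map LinearMap.id (rho n w⁻¹) (MulOpposite.op f • x) =
          MulOpposite.op f • TensorProduct.map (LinearMap.id (M := A7 θ)) (rho n w⁻¹) x := by
      induction x with
      | zero => simp
      | add x y hx hy => rw [smul_add, map_add, hx, hy, map_add, smul_add]
      | tmul a v => rfl
    rw [h1, h2, hφ w]

/-- The `A(S_{θ'}^7)`-valued hermitian structure `⟨ξ|η⟩ = ∑_b ξ_b^* η_b`. -/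
def braket {θ : ℝ} {ι : Type} [Fintype ι] (ξ η : ι → A7 θ) : A7 θ := ∑ b, star (ξ b) * η b

/-- The tensor product `|ψ_{i_1}⟩ ⊗ ⋯ ⊗ |ψ_{i_n}⟩` in `A(S_{θ'}^7)^{4^n}`. The coordinates of
`A^{4^n}` are indexed by `Fin n → Fin 4`. -/
def ketTensor (θ : ℝ) {n : ℕ} (i : Fin n → Fin 2) : (Fin n → Fin 4) → A7 θ :=
  fun I => (List.ofFn fun t => Psi θ (I t) (i t)).prod

/-- The vector `|φ_k⟩`, numbered from `k = 0`: the sum of the `n.choose k` tensor products of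
`n - k` factors `|ψ_1⟩` and `k` factors `|ψ_2⟩`, divided by `√(n.choose k)`. -/
def phi (θ : ℝ) (n : ℕ) (k : Fin (n + 1)) : (Fin n → Fin 4) → A7 θ :=
  ((Real.sqrt (n.choose k) : ℝ) : ℂ)⁻¹ • ∑ i ∈ arrangements n k, ketTensor θ i

/-- The matrix `p_{(n)} = ∑_k |φ_k⟩⟨φ_k|`, as a matrix with entries in `A(S_{θ'}^7)`. -/
def projN (θ : ℝ) (n : ℕ) : Matrix (Fin n → Fin 4) (Fin n → Fin 4) (A7 θ) :=
  Matrix.of fun I J => ∑ k, phi θ n k I * star (phi θ n k J)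

/-- A square matrix over a ring `A` acts on columns as a map of right `A`-modules. -/
def colMap {A ι : Type} [Ring A] [Fintype ι] (P : Matrix ι ι A) : (ι → A) →ₗ[Aᵐᵒᵖ] (ι → A) where
  toFun f := P.mulVec f
  map_add' f g := P.mulVec_add f g
  map_smul' c f := by
    ext i
    simp [Matrix.mulVec, dotProduct, Finset.sum_mul, mul_assoc]

end NCHopf

end

open NCHopf

noncomputable section

namespace NCHopf

/-! ### Words in the entries of `Ψ`, and the invariant elements -/

/-! The 2 × 2 minors `bracket` of Ψ are multiplied by det w = 1 under `alpha`, so they are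
invariant. They commute with the entries of Ψ up to phases, and up to scalars they are (1 ± z_0)/2,
z_1, z_2 and the adjoints of z_1, z_2.

The key fact is that every invariant lies in the image of `hopf` (`mem_base_of_invariant`). Filter
A(S^7) by right submodules over A(S^4) generated by words of bounded length in the entries of Ψ.
Exchanging two adjacent column indices creates a minor, which moves to the far right and is absorbed
into the base. Modulo shorter words, the words of length m with given rows thus transform as a
quotient of Sym^m. This has no invariants for m > 0: project onto weight zero by a torus average,
rotate, and project again; the result is a scalar different from 1 (`coeff_expand_ne`). Invariants
therefore descend to length zero (`mem_wordSpan_of_invariant`).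

Injectivity of `hopf` is tested on representations. A point of S^7 gives a representation by Weyl
operators; composed with `hopf`, it sends z_0 to q_0 and z_1, z_2 to q_1, q_2 times invertible
operators, and every q in S^4 except one pole occurs (`exists_pointRep`). Elements of A(S^4) have
the form u + z_0 v with u, v combinations of ordered monomials (`exists_normalForm`), and letting q
vary forces all coefficients to vanish.

For the modules, Ψ^*Ψ = 1 makes the φ_k orthonormal, so p_(n) is a projection. Pairing tensors of
columns of Ψ with an equivariant element produces invariants, hence elements of the base. This puts
the entries of p_(n) in A(S^4) and supplies the preimages that make |f⟩ ↦ ∑ ⟨φ_k|f⟩ ⊗ e_k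
surjective. This map and p_(n) have the same fibres, whence the isomorphism. -/

section words

variable (θ : ℝ)

/-- The product of the entries of `Ψ` listed in `l`. -/
def word (l : List (Fin 4 × Fin 2)) : A7 θ := (l.map fun p => Psi θ p.1 p.2).prod

@[simp] theorem word_nil : word θ [] = 1 := rfl

@[simp] theorem word_cons (p : Fin 4 × Fin 2) (l : List (Fin 4 × Fin 2)) :
    word θ (p :: l) = Psi θ p.1 p.2 * word θ l := by simp [word]

theorem bracket_mul_Psi (a b c : Fin 4) (i : Fin 2) :
    QC θ (theta7 θ a c + theta7 θ b c) (bracket θ a b) (Psi θ c i) := by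
  have P (a b : Fin 4) (i j : Fin 2) : QC θ (theta7 θ a b) (Psi θ a i) (Psi θ b j) :=
    Psi_comm θ a b i j
  exact ((P _ _ _ _).mul_left (P _ _ _ _)).sub_left ((P _ _ _ _).mul_left (P _ _ _ _))

/-- The scalar is a product of phases whose value never matters: what counts is that a minor can be
carried to the far right, where the base acts. -/
theorem bracket_mul_word (a b : Fin 4) (l : List (Fin 4 × Fin 2)) :
    ∃ c : ℂ, bracket θ a b * word θ l = c • (word θ l * bracket θ a b) := by
  induction l with
  | nil => exact ⟨1, by simp⟩
  | cons p l ih =>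
    obtain ⟨c, hc⟩ := ih
    obtain ⟨e, h⟩ : ∃ e : ℂ, bracket θ a b * Psi θ p.1 p.2 = e • (Psi θ p.1 p.2 * bracket θ a b) :=
      ⟨_, bracket_mul_Psi θ a b p.1 p.2⟩
    rw [word_cons, ← mul_assoc, h, smul_mul_assoc, mul_assoc, hc, mul_smul_comm, smul_smul,
      ← mul_assoc]
    exact ⟨e * c, rfl⟩

theorem bracket_swap (a b : Fin 4) :
    bracket θ b a = -(phase (theta7 θ) b a • bracket θ a b) := by
  rw [bracket, bracket, Psi_comm θ b a, Psi_comm θ b a 1 0]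
  module

theorem bracket_self (a : Fin 4) : bracket θ a a = 0 := by
  rw [bracket, Psi_comm θ a a 0 1, phase, show theta7 θ a a = 0 by fin_cases a <;> simp [theta7]]
  simp

/-- This is the spherical relation. Since z_0 is the difference of the same two minors, each of them
is affine in z_0. -/
theorem bracket_add_bracket : bracket θ 0 1 + bracket θ 2 3 = 1 := by
  have hs : ∑ a, star (psi θ a) * psi θ a = 1 := gen_sphere (theta7 θ)
  rw [Fin.sum_univ_four] at hs
  rw [← hs]
  simp [bracket, Psi, psi_normal]
  abel

/-- The elements of `A(S_{θ'}^7)` that come from `A(S_θ^4)`. -/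
def base : Subalgebra ℂ (A7 θ) := (hopf θ : A4 θ →ₐ[ℂ] A7 θ).range

theorem mem_base {x : A7 θ} : x ∈ base θ ↔ ∃ y, hopf θ y = x := Iff.rfl

theorem hopfZ_mem_base (μ : Fin 3) : hopfZ θ μ ∈ base θ := ⟨_, hopf_gen θ μ⟩

theorem star_hopfZ_mem_base (μ : Fin 3) : star (hopfZ θ μ) ∈ base θ :=
  ⟨star (PresStarAlg.gen _ μ), by
    change hopf θ _ = _
    rw [map_star, hopf_gen]⟩

/-- Reversing the factors costs the same phase in both terms of the minor, which turns it into a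
multiple of the adjoint of the complementary minor. -/
theorem bracket_zero_two : bracket θ 0 2 =
    ((1 / 2 : ℂ) * phase (theta7 θ) 3 0) • star (hopfZ θ 2) := by
  have e1 : psi θ 0 * star (psi θ 3) = phase (theta7 θ) 3 0 • (star (psi θ 3) * psi θ 0) :=
    gen_comm_star (theta7 θ) 0 3
  have e2 : star (psi θ 1) * psi θ 2 = phase (theta7 θ) 3 0 • (psi θ 2 * star (psi θ 1)) :=
    psi_star_comm' θ 1 2 (by simp [theta7])
  rw [hopfZ_two]
  simp [bracket, Psi, e1, e2]
  module

theorem bracket_one_two : bracket θ 1 2 =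
    (-(1 / 2 : ℂ) * phase (theta7 θ) 3 1) • star (hopfZ θ 1) := by
  have e1 : psi θ 1 * star (psi θ 3) = phase (theta7 θ) 3 1 • (star (psi θ 3) * psi θ 1) :=
    gen_comm_star (theta7 θ) 1 3
  have e2 : star (psi θ 0) * psi θ 2 = phase (theta7 θ) 3 1 • (psi θ 2 * star (psi θ 0)) :=
    psi_star_comm' θ 0 2 (by simp [theta7])
  rw [hopfZ_one]
  simp [bracket, Psi, e1, e2]
  module

theorem bracket_mem_base_of_lt {a b : Fin 4} (h : a < b) : bracket θ a b ∈ base θ := by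
  have h01 : bracket θ 0 1 = (1 / 2 : ℂ) • (1 + hopfZ θ 0) := by
    rw [hopfZ_zero, ← bracket_add_bracket]; module
  have h23 : bracket θ 2 3 = (1 / 2 : ℂ) • (1 - hopfZ θ 0) := by
    rw [hopfZ_zero, ← bracket_add_bracket]; module
  have h03 : bracket θ 0 3 = (1 / 2 : ℂ) • hopfZ θ 1 := by rw [hopfZ_one]; module
  have h13 : bracket θ 1 3 = (1 / 2 : ℂ) • hopfZ θ 2 := by rw [hopfZ_two]; module
  have m (μ : Fin 3) (c : ℂ) : c • hopfZ θ μ ∈ base θ :=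
    Subalgebra.smul_mem _ (hopfZ_mem_base θ μ) c
  have ms (μ : Fin 3) (c : ℂ) : c • star (hopfZ θ μ) ∈ base θ :=
    Subalgebra.smul_mem _ (star_hopfZ_mem_base θ μ) c
  fin_cases a <;> fin_cases b <;> first | exact absurd h (by decide) | skip
  · change bracket θ 0 1 ∈ _
    rw [h01]
    exact Subalgebra.smul_mem _ (add_mem (one_mem _) (hopfZ_mem_base θ 0)) _
  · change bracket θ 0 2 ∈ _
    rw [bracket_zero_two]; exact ms _ _
  · change bracket θ 0 3 ∈ _
    rw [h03]; exact m _ _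
  · change bracket θ 1 2 ∈ _
    rw [bracket_one_two]; exact ms _ _
  · change bracket θ 1 3 ∈ _
    rw [h13]; exact m _ _
  · change bracket θ 2 3 ∈ _
    rw [h23]
    exact Subalgebra.smul_mem _ (sub_mem (one_mem _) (hopfZ_mem_base θ 0)) _

theorem bracket_mem_base (a b : Fin 4) : bracket θ a b ∈ base θ := by
  rcases lt_trichotomy a b with h | rfl | h
  · exact bracket_mem_base_of_lt θ h
  · rw [bracket_self]; exact zero_mem _
  · rw [bracket_swap]
    exact neg_mem (Subalgebra.smul_mem _ (bracket_mem_base_of_lt θ h) _)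

/-- The right `A(S_θ^4)`-submodule of `A(S_{θ'}^7)` generated by the words of length at most `k`. -/
def wordSpan (k : ℕ) : Submodule (A4 θ)ᵐᵒᵖ (A7 θ) :=
  Submodule.span _ {x | ∃ l : List (Fin 4 × Fin 2), l.length ≤ k ∧ word θ l = x}

variable {θ}

theorem word_mem_wordSpan {k : ℕ} {l : List (Fin 4 × Fin 2)} (h : l.length ≤ k) :
    word θ l ∈ wordSpan θ k := Submodule.subset_span ⟨l, h, rfl⟩

theorem mul_base_mem_wordSpan {k : ℕ} {x y : A7 θ} (hx : x ∈ wordSpan θ k) (hy : y ∈ base θ) :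
    x * y ∈ wordSpan θ k := by
  obtain ⟨f, rfl⟩ := hy
  exact Submodule.smul_mem _ (MulOpposite.op f) hx

theorem smul_mem_wordSpan {k : ℕ} {x : A7 θ} (hx : x ∈ wordSpan θ k) (c : ℂ) :
    c • x ∈ wordSpan θ k := by
  have := mul_base_mem_wordSpan hx (Subalgebra.algebraMap_mem (base θ) c)
  rwa [← Algebra.commutes, ← Algebra.smul_def] at this

theorem wordSpan_mono {k k' : ℕ} (h : k ≤ k') : wordSpan θ k ≤ wordSpan θ k' :=
  Submodule.span_mono fun _ ⟨l, hl, e⟩ => ⟨l, hl.trans h, e⟩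

theorem Psi_mul_mem_wordSpan {k : ℕ} {x : A7 θ} (hx : x ∈ wordSpan θ k) (a : Fin 4) (i : Fin 2) :
    Psi θ a i * x ∈ wordSpan θ (k + 1) := by
  induction hx using Submodule.span_induction with
  | mem x h =>
    obtain ⟨l, hl, rfl⟩ := h
    rw [← word_cons θ (a, i) l]
    exact word_mem_wordSpan (by simpa using hl)
  | zero => simp
  | add x y _ _ hx hy => rw [mul_add]; exact add_mem hx hy
  | smul f x _ hx =>
    obtain ⟨f, rfl⟩ := MulOpposite.op_surjective f
    rw [op_smul_def, ← mul_assoc, ← op_smul_def]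
    exact Submodule.smul_mem _ _ hx

/-- A minor has degree two in Ψ but costs no length, since on the right it is a coefficient from the
base. -/
theorem bracket_mul_word_mem_wordSpan {k : ℕ} {l : List (Fin 4 × Fin 2)} (h : l.length ≤ k)
    (a b : Fin 4) : bracket θ a b * word θ l ∈ wordSpan θ k := by
  obtain ⟨c, hc⟩ := bracket_mul_word θ a b l
  rw [hc]
  exact smul_mem_wordSpan (mul_base_mem_wordSpan (word_mem_wordSpan h) (bracket_mem_base θ a b)) c

theorem Psi_mul_Psi_swap (a b : Fin 4) (i j : Fin 2) : ∃ c : ℂ,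
    Psi θ a i * Psi θ b j - Psi θ a j * Psi θ b i = c • bracket θ a b := by
  fin_cases i <;> fin_cases j
  · exact ⟨0, by simp⟩
  · exact ⟨1, by simp [bracket]⟩
  · exact ⟨-1, by simp [bracket]⟩
  · exact ⟨0, by simp⟩

/-- Up to shorter words, permuting the column indices does not change a word. -/
theorem word_zip_perm {i j : List (Fin 2)} (h : i.Perm j) : ∀ (k : ℕ) (a : List (Fin 4)),
    a.length = i.length → a.length ≤ k + 1 → word θ (a.zip i) - word θ (a.zip j) ∈ wordSpan θ k := by
  induction h with
  | nil => intro k a _ _; simp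
  | @cons x i j h ih =>
    intro k a ha hk
    obtain _ | ⟨a, as⟩ := a
    · simp
    rw [List.zip_cons_cons, List.zip_cons_cons, word_cons, word_cons, ← mul_sub]
    -- With `k = 0` there is a single letter, and the two words coincide.
    obtain _ | k := k
    · obtain rfl : as = [] := List.length_eq_zero_iff.1 (by simpa using hk)
      simp
    · exact Psi_mul_mem_wordSpan (ih k as (by simpa using ha) (by simpa using hk)) a x
  | swap x y i =>
    intro k a ha hk
    obtain _ | ⟨a, _ | ⟨b, as⟩⟩ := a
    · simp
    · simp at ha
    -- The rows stay in place while the columns are exchanged, so the difference is a multiple of a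
    -- minor times the word without its first two letters.
    obtain ⟨c, hc⟩ := Psi_mul_Psi_swap (θ := θ) a b y x
    simp only [List.zip_cons_cons, word_cons, ← mul_assoc]
    rw [← sub_mul, hc, smul_mul_assoc]
    refine smul_mem_wordSpan (bracket_mul_word_mem_wordSpan ?_ a b) c
    simp only [List.length_cons, List.length_zip] at *
    omega
  | @trans i j l h1 h2 ih1 ih2 =>
    intro k a ha hk
    have := add_mem (ih1 k a ha hk) (ih2 k a (ha.trans h1.length_eq) hk)
    rwa [sub_add_sub_cancel] at this

/-- Each generator and each adjoint is an entry of Ψ up to sign. The induction is on left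
multiplication, which is compatible with the right module structure and adds one letter at a time.
-/
theorem exists_mem_wordSpan (x : A7 θ) : ∃ k, x ∈ wordSpan θ k := by
  suffices H : ∀ (y : FreeStarAlg (Fin 4)) (x : A7 θ), (∃ k, x ∈ wordSpan θ k) →
      ∃ k, PresStarAlg.mk _ y * x ∈ wordSpan θ k by
    obtain ⟨y, rfl⟩ := PresStarAlg.mk_surjective x
    rw [← mul_one (PresStarAlg.mk _ y)]
    exact H y 1 ⟨0, word_mem_wordSpan (l := []) (by simp)⟩
  intro y
  induction y using FreeStarAlg.induct with
  | h0 c =>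
    rintro x ⟨k, hk⟩
    rw [AlgHomClass.commutes, ← Algebra.smul_def]
    exact ⟨k, smul_mem_wordSpan hk c⟩
  | h1 y =>
    rintro x ⟨k, hk⟩
    refine ⟨k + 1, ?_⟩
    have hP (a : Fin 4) : (∃ b i, psi θ a = Psi θ b i) ∧
        ∃ b i, star (psi θ a) = Psi θ b i ∨ star (psi θ a) = -Psi θ b i := by
      fin_cases a
      · exact ⟨⟨0, 0, rfl⟩, 1, 1, Or.inl rfl⟩
      · exact ⟨⟨1, 0, rfl⟩, 0, 1, Or.inr (by simp [Psi])⟩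
      · exact ⟨⟨2, 0, rfl⟩, 3, 1, Or.inl rfl⟩
      · exact ⟨⟨3, 0, rfl⟩, 2, 1, Or.inr (by simp [Psi])⟩
    obtain ⟨a, _ | _⟩ := y
    · obtain ⟨⟨b, i, h⟩, _⟩ := hP a
      change psi θ a * x ∈ _
      rw [h]
      exact Psi_mul_mem_wordSpan hk b i
    · obtain ⟨_, b, i, h⟩ := hP a
      have e : PresStarAlg.mk (SphereRel (theta7 θ)) (FreeStarAlg.letter (a, true)) =
          star (psi θ a) := by
        rw [psi, PresStarAlg.gen, ← map_star, FreeStarAlg.gen, FreeStarAlg.star_letter]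
        rfl
      rw [e]
      rcases h with h | h <;> rw [h]
      · exact Psi_mul_mem_wordSpan hk b i
      · rw [neg_mul]
        exact neg_mem (Psi_mul_mem_wordSpan hk b i)
  | h2 a b ha hb =>
    intro x hx
    rw [map_mul, mul_assoc]
    exact ha _ (hb _ hx)
  | h3 a b ha hb =>
    intro x hx
    obtain ⟨k, hk⟩ := ha x hx
    obtain ⟨l, hl⟩ := hb x hx
    refine ⟨max k l, ?_⟩
    rw [map_add, add_mul]
    exact add_mem (wordSpan_mono (le_max_left _ _) hk) (wordSpan_mono (le_max_right _ _) hl)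

theorem wordSpan_zero {x : A7 θ} (h : x ∈ wordSpan θ 0) : x ∈ base θ := by
  induction h using Submodule.span_induction with
  | mem x h =>
    obtain ⟨l, hl, rfl⟩ := h
    obtain rfl : l = [] := List.length_eq_zero_iff.1 (by simpa using hl)
    exact one_mem _
  | zero => exact zero_mem _
  | add x y _ _ hx hy => exact add_mem hx hy
  | smul f x _ hx =>
    obtain ⟨f, rfl⟩ := MulOpposite.op_surjective f
    exact mul_mem hx ⟨f, rfl⟩

end words

/-! ### Invariant elements: weights, torus averages and a rotation. -/

section invariants

variable (θ : ℝ)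

/-- The number of indices equal to `1`. -/
def ones {n : ℕ} (i : Fin n → Fin 2) : ℕ := (Finset.univ.filter fun t => i t = 1).card

theorem ones_eq_sum {n : ℕ} (i : Fin n → Fin 2) : ones i = ∑ t, (i t : ℕ) := by
  rw [ones, Finset.card_filter]
  refine Finset.sum_congr rfl fun t _ => ?_
  generalize i t = x
  fin_cases x <;> rfl

theorem count_ofFn {n : ℕ} (i : Fin n → Fin 2) (x : Fin 2) :
    (List.ofFn i).count x = (Finset.univ.filter fun t => i t = x).card := by
  induction n with
  | zero => simp
  | succ n ih =>
    rw [List.ofFn_succ, List.count_cons, ih, Fin.card_filter_univ_succ]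
    by_cases h : i 0 = x <;> simp [h]

theorem ofFn_perm_of_ones_eq {n : ℕ} {i j : Fin n → Fin 2} (h : ones i = ones j) :
    (List.ofFn i).Perm (List.ofFn j) := by
  have h0 (i : Fin n → Fin 2) : (List.ofFn i).count 0 + ones i = n := by
    rw [count_ofFn, ones]
    have e : (fun t => i t = 1) = fun t => ¬ i t = 0 := by
      funext t
      generalize i t = x
      fin_cases x <;> simp
    simp only [e]
    rw [Finset.card_filter_add_card_filter_not, Finset.card_fin]
  rw [List.perm_iff_count]
  intro x
  fin_cases x
  · have := h0 i
    have := h0 j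
    simp only [Fin.zero_eta]
    omega
  · simpa [count_ofFn, ones] using h

theorem ketTensor_eq_word {n : ℕ} (i : Fin n → Fin 2) (I : Fin n → Fin 4) :
    ketTensor θ i I = word θ ((List.ofFn I).zip (List.ofFn i)) := by
  rw [ketTensor, word]
  congr 1
  apply List.ext_getElem <;> simp

theorem word_eq_ketTensor (l : List (Fin 4 × Fin 2)) :
    word θ l = ketTensor θ (fun t : Fin l.length => (l.get t).2) (fun t => (l.get t).1) := by
  rw [ketTensor, word]
  congr 1
  apply List.ext_getElem <;> simp

theorem ketTensor_cons {n : ℕ} (i : Fin (n + 1) → Fin 2) (a : Fin 4) (I : Fin n → Fin 4) :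
    ketTensor θ i (Fin.cons a I) = Psi θ a (i 0) * ketTensor θ (Fin.tail i) I := by
  simp [ketTensor, List.ofFn_succ, Fin.tail]

theorem ketTensor_mem_wordSpan {n : ℕ} (i : Fin n → Fin 2) (I : Fin n → Fin 4) :
    ketTensor θ i I ∈ wordSpan θ n := by
  rw [ketTensor_eq_word]
  exact word_mem_wordSpan (by simp)

/-- For fixed rows, only the weight of the column indices survives modulo shorter words, as in a
symmetric power. -/
theorem ketTensor_sub_mem_wordSpan {n : ℕ} {i j : Fin (n + 1) → Fin 2} (h : ones i = ones j)
    (I : Fin (n + 1) → Fin 4) : ketTensor θ i I - ketTensor θ j I ∈ wordSpan θ n := by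
  rw [ketTensor_eq_word, ketTensor_eq_word]
  exact word_zip_perm (ofFn_perm_of_ones_eq h) _ _ (by simp) (by simp)

theorem alpha_ketTensor (w : SU2) {n : ℕ} (i : Fin n → Fin 2) (I : Fin n → Fin 4) :
    alpha θ w (ketTensor θ i I) =
      ∑ j : Fin n → Fin 2, (∏ t, (w : Matrix (Fin 2) (Fin 2) ℂ) (j t) (i t)) • ketTensor θ j I := by
  induction n with
  | zero => simp [ketTensor]
  | succ n ih =>
    obtain ⟨a, I, rfl⟩ : ∃ a I', I = Fin.cons a I' := ⟨I 0, Fin.tail I, (Fin.cons_self_tail I).symm⟩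
    rw [ketTensor_cons, map_mul, alpha_Psi, ih, Finset.sum_mul_sum,
      ← (Fin.consEquiv fun _ => Fin 2).sum_comp, Fintype.sum_prod_type]
    refine Finset.sum_congr rfl fun b _ => Finset.sum_congr rfl fun j _ => ?_
    simp [Fin.consEquiv, ketTensor_cons, Fin.prod_univ_succ, smul_smul, Fin.tail, mul_comm]

theorem alpha_op_smul (w : SU2) (f : (A4 θ)ᵐᵒᵖ) (x : A7 θ) :
    alpha θ w (f • x) = f • alpha θ w x := by
  obtain ⟨f, rfl⟩ := MulOpposite.op_surjective f
  rw [op_smul_def, op_smul_def, map_mul, alpha_hopf]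

/-- The action of `w` as a map of right `A(S_θ^4)`-modules. -/
def alphaLin (w : SU2) : A7 θ →ₗ[(A4 θ)ᵐᵒᵖ] A7 θ where
  toFun := alpha θ w
  map_add' := map_add _
  map_smul' := alpha_op_smul θ w

variable {θ} in
theorem alpha_mem_wordSpan (w : SU2) {k : ℕ} {x : A7 θ} (hx : x ∈ wordSpan θ k) :
    alpha θ w x ∈ wordSpan θ k := by
  have : wordSpan θ k ≤ (wordSpan θ k).comap (alphaLin θ w) := by
    refine Submodule.span_le.2 ?_
    rintro _ ⟨l, hl, rfl⟩
    change alpha θ w (word θ l) ∈ wordSpan θ k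
    rw [word_eq_ketTensor, alpha_ketTensor]
    exact sum_mem fun j _ => smul_mem_wordSpan (wordSpan_mono hl (ketTensor_mem_wordSpan θ _ _)) _
  exact this hx

/-- The diagonal element of `SU(2)` with entries `z` and `z⁻¹`. -/
def torusElt (z : ℂ) (hz : z * star z = 1) : SU2 :=
  ⟨!![z, 0; 0, star z], by
    rw [Matrix.mem_specialUnitaryGroup_iff, Matrix.mem_unitaryGroup_iff]
    have hz' : star z * z = 1 := by rw [mul_comm, hz]
    refine ⟨?_, by simpa [Matrix.det_fin_two] using hz⟩
    ext i j
    fin_cases i <;> fin_cases j <;>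
      simp [Matrix.mul_apply, Fin.sum_univ_two, Matrix.star_apply] <;> first | exact hz | exact hz'⟩

/-- A rotation by an angle of `π / 4`. -/
def rotElt : SU2 :=
  ⟨!![((Real.sqrt 2)⁻¹ : ℝ), -((Real.sqrt 2)⁻¹ : ℝ);
      ((Real.sqrt 2)⁻¹ : ℝ), ((Real.sqrt 2)⁻¹ : ℝ)], by
    have h : (((Real.sqrt 2)⁻¹ : ℝ) : ℂ) * (((Real.sqrt 2)⁻¹ : ℝ) : ℂ) = 1 / 2 := by
      rw [← Complex.ofReal_mul, ← mul_inv, Real.mul_self_sqrt (by norm_num)]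
      norm_num
    generalize hs : (Real.sqrt 2)⁻¹ = s at h ⊢
    rw [Matrix.mem_specialUnitaryGroup_iff, Matrix.mem_unitaryGroup_iff]
    refine ⟨?_, ?_⟩
    · ext i j
      fin_cases i <;> fin_cases j <;>
        simp [Matrix.mul_apply, Fin.sum_univ_two, Matrix.star_apply, h] <;> norm_num
    · simp [Matrix.det_fin_two, h]; norm_num⟩

theorem prod_zpow_eq_zpow_sum {ι : Type} {z : ℂ} (hz : z ≠ 0) (s : Finset ι) (f : ι → ℤ) :
    ∏ t ∈ s, z ^ f t = z ^ ∑ t ∈ s, f t := by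
  classical
  induction s using Finset.induction_on with
  | empty => simp
  | insert a s ha ih => rw [Finset.prod_insert ha, Finset.sum_insert ha, ih, zpow_add₀ hz]

theorem alpha_torusElt (z : ℂ) (hz : z * star z = 1) {n : ℕ} (i : Fin n → Fin 2)
    (I : Fin n → Fin 4) : alpha θ (torusElt z hz) (ketTensor θ i I) =
      (z ^ ((n : ℤ) - 2 * ones i)) • ketTensor θ i I := by
  have hz0 : z ≠ 0 := by rintro rfl; simp at hz
  have hz1 : star z = z⁻¹ := eq_inv_of_mul_eq_one_right hz
  rw [alpha_ketTensor, Finset.sum_eq_single i]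
  · congr 1
    have (t : Fin n) : (torusElt z hz : Matrix (Fin 2) (Fin 2) ℂ) (i t) (i t) =
        z ^ (1 - 2 * ((i t : ℕ) : ℤ)) := by
      generalize i t = x
      fin_cases x
      · simp [torusElt]
      · simpa [torusElt] using hz1
    simp only [this]
    rw [prod_zpow_eq_zpow_sum hz0, ones_eq_sum]
    congr 1
    simp [Finset.sum_sub_distrib, Finset.mul_sum]
  · intro j _ hj
    obtain ⟨t, ht⟩ := Function.ne_iff.1 hj
    rw [Finset.prod_eq_zero (Finset.mem_univ t), zero_smul]
    revert ht
    generalize i t = x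
    generalize j t = y
    fin_cases x <;> fin_cases y <;> simp [torusElt]
  · simp

/-- A primitive root of unity of order `k + 1`. -/
def rootOfUnity (k : ℕ) : ℂ := Complex.exp (2 * Real.pi * Complex.I / ((k + 1 : ℕ) : ℂ))

theorem rootOfUnity_isPrimitiveRoot (k : ℕ) : IsPrimitiveRoot (rootOfUnity k) (k + 1) :=
  Complex.isPrimitiveRoot_exp _ (Nat.succ_ne_zero k)

theorem rootOfUnity_pow_mul_star (k j : ℕ) :
    rootOfUnity k ^ j * star (rootOfUnity k ^ j) = 1 := by
  have h : ‖rootOfUnity k ^ j‖ = 1 := by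
    rw [norm_pow, (rootOfUnity_isPrimitiveRoot k).norm'_eq_one (Nat.succ_ne_zero k), one_pow]
  rw [Complex.star_def, Complex.mul_conj, Complex.normSq_eq_norm_sq, h]
  simp

/-- The weights of a word of length `k` lie between `-k` and `k`. The only multiple of `k + 1` in
that range is 0, so a cyclic group of order `k + 1` already isolates weight zero and no integration
over the torus is needed. -/
theorem sum_rootOfUnity (k : ℕ) (e : ℤ) (h : |e| ≤ k) :
    ∑ j ∈ Finset.range (k + 1), (rootOfUnity k ^ j) ^ e =
      if e = 0 then ((k + 1 : ℕ) : ℂ) else 0 := by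
  split_ifs with he
  · simp [he]
  · have hp := rootOfUnity_isPrimitiveRoot k
    have h1 : rootOfUnity k ^ e ≠ 1 := by
      rw [Ne, hp.zpow_eq_one_iff_dvd]
      intro hd
      have := Int.eq_zero_of_abs_lt_dvd hd (by push_cast; omega)
      exact he this
    have h2 (j : ℕ) : (rootOfUnity k ^ j) ^ e = (rootOfUnity k ^ e) ^ j := by
      rw [← zpow_natCast, ← zpow_mul, mul_comm, zpow_mul, zpow_natCast]
    simp only [h2]
    rw [geom_sum_eq h1, ← h2, hp.pow_eq_one, one_zpow, sub_self, zero_div]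

/-- The average over a finite subgroup of the diagonal torus. -/
def torusAvg (k : ℕ) : A7 θ →ₗ[(A4 θ)ᵐᵒᵖ] A7 θ :=
  ((k + 1 : ℕ) : ℂ)⁻¹ • ∑ j ∈ Finset.range (k + 1),
    alphaLin θ (torusElt (rootOfUnity k ^ j) (rootOfUnity_pow_mul_star k j))

theorem torusAvg_apply (k : ℕ) (x : A7 θ) : torusAvg θ k x =
    ((k + 1 : ℕ) : ℂ)⁻¹ • ∑ j ∈ Finset.range (k + 1),
      alpha θ (torusElt (rootOfUnity k ^ j) (rootOfUnity_pow_mul_star k j)) x := by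
  simp [torusAvg, alphaLin]

theorem torusAvg_smul (k : ℕ) (c : ℂ) (x : A7 θ) :
    torusAvg θ k (c • x) = c • torusAvg θ k x := by
  simp only [torusAvg_apply, map_smul]
  rw [← Finset.smul_sum, smul_comm]

theorem torusAvg_of_invariant (k : ℕ) {x : A7 θ} (hx : ∀ w, alpha θ w x = x) :
    torusAvg θ k x = x := by
  have : ((k + 1 : ℕ) : ℂ) ≠ 0 := Nat.cast_ne_zero.2 (Nat.succ_ne_zero k)
  simp only [torusAvg_apply, hx, Finset.sum_const, Finset.card_range]
  rw [← Nat.cast_smul_eq_nsmul ℂ, smul_smul, inv_mul_cancel₀ this, one_smul]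

theorem ones_le {n : ℕ} (i : Fin n → Fin 2) : ones i ≤ n :=
  (Finset.card_le_univ _).trans (Fintype.card_fin n).le

theorem torusAvg_ketTensor {k : ℕ} (i : Fin k → Fin 2) (I : Fin k → Fin 4) :
    torusAvg θ k (ketTensor θ i I) = if 2 * ones i = k then ketTensor θ i I else 0 := by
  have h0 : ((k + 1 : ℕ) : ℂ) ≠ 0 := Nat.cast_ne_zero.2 (Nat.succ_ne_zero k)
  have h1 := ones_le i
  simp only [torusAvg_apply, alpha_torusElt, ← Finset.sum_smul]
  rw [sum_rootOfUnity k _ (abs_le.2 ⟨by omega, by omega⟩)]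
  by_cases h : 2 * ones i = k
  · rw [if_pos h, if_pos (by omega), smul_smul, inv_mul_cancel₀ h0, one_smul]
  · rw [if_neg h, if_neg (by omega), zero_smul, smul_zero]

variable {θ} in
theorem torusAvg_mem_wordSpan (k : ℕ) {l : ℕ} {x : A7 θ} (hx : x ∈ wordSpan θ l) :
    torusAvg θ k x ∈ wordSpan θ l := by
  rw [torusAvg_apply]
  exact smul_mem_wordSpan (sum_mem fun j _ => alpha_mem_wordSpan _ hx) _

-- A generating function: the exponent of X counts the factors taken from row 1 of the matrix, so a
-- coefficient collects the entries of w ⊗ ⋯ ⊗ w leading to one weight.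
open Polynomial in
theorem coeff_prod_columns {k : ℕ} (w : Matrix (Fin 2) (Fin 2) ℂ) (i : Fin k → Fin 2) (l : ℕ) :
    (∏ t, (C (w 0 (i t)) + C (w 1 (i t)) * X)).coeff l =
      ∑ j : Fin k → Fin 2, if ones j = l then ∏ t, w (j t) (i t) else 0 := by
  have h (t : Fin k) : C (w 0 (i t)) + C (w 1 (i t)) * X =
      ∑ b : Fin 2, C (w b (i t)) * (X : ℂ[X]) ^ (b : ℕ) := by
    simp [Fin.sum_univ_two]
  simp only [h]
  rw [Finset.prod_univ_sum, Polynomial.finsetSum_coeff, Fintype.piFinset_univ]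
  refine Finset.sum_congr rfl fun j _ => ?_
  rw [Finset.prod_mul_distrib, Finset.prod_pow_eq_pow_sum, ← ones_eq_sum, ← map_prod, coeff_C_mul,
    coeff_X_pow]
  simp [eq_comm]

-- With s = 1/√2, a column index 0 contributes s(X + 1) and an index 1 contributes s(X - 1). At
-- weight zero there are `l` of each, and s² = 1/2.
open Polynomial in
theorem prod_columns_rotElt {l : ℕ} (i : Fin (2 * l) → Fin 2) (hi : ones i = l) :
    ∏ t, (C ((rotElt : Matrix (Fin 2) (Fin 2) ℂ) 0 (i t)) +
      C ((rotElt : Matrix (Fin 2) (Fin 2) ℂ) 1 (i t)) * X) =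
      C ((1 / 2 : ℂ) ^ l) * expand ℂ 2 ((X - C 1) ^ l) := by
  have hs : (((Real.sqrt 2)⁻¹ : ℝ) : ℂ) * (((Real.sqrt 2)⁻¹ : ℝ) : ℂ) = 1 / 2 := by
    rw [← Complex.ofReal_mul, ← mul_inv, Real.mul_self_sqrt (by norm_num)]
    norm_num
  have h (t : Fin (2 * l)) : C ((rotElt : Matrix (Fin 2) (Fin 2) ℂ) 0 (i t)) +
      C ((rotElt : Matrix (Fin 2) (Fin 2) ℂ) 1 (i t)) * X =
      C (((Real.sqrt 2)⁻¹ : ℝ) : ℂ) * (if i t = 1 then X - C 1 else X + C 1) := by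
    generalize i t = x
    generalize hr : (Real.sqrt 2)⁻¹ = r
    fin_cases x <;> simp [rotElt, hr] <;> ring
  have hc : (Finset.univ.filter fun t => ¬ i t = 1).card = l := by
    have := Finset.card_filter_add_card_filter_not (s := (Finset.univ : Finset (Fin (2 * l))))
      (fun t => i t = 1)
    rw [Finset.card_fin] at this
    rw [ones] at hi
    omega
  simp only [h]
  rw [Finset.prod_mul_distrib, Finset.prod_ite, Finset.prod_const, Finset.prod_const,
    Finset.prod_const, hc, Finset.card_fin]
  rw [ones] at hi
  rw [hi, ← mul_pow, ← C_pow, pow_mul, sq, hs, map_pow]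
  congr 2
  simp
  ring

-- The coefficient vanishes for odd `l`; otherwise its modulus is a binomial coefficient over 2^l,
-- which is less than 1. Here the absence of invariants in Sym^{2l} for `l > 0` becomes a numerical
-- inequality.
open Polynomial in
theorem coeff_expand_ne (l : ℕ) (hl : 0 < l) :
    (C ((1 / 2 : ℂ) ^ l) * expand ℂ 2 ((X - C 1) ^ l)).coeff l ≠ 1 := by
  rw [coeff_C_mul, coeff_expand (by norm_num)]
  split_ifs with h
  · rw [sub_eq_add_neg, ← C_neg, coeff_X_add_C_pow]
    intro h1
    have h2 := congrArg (‖·‖) h1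
    simp only [norm_mul, norm_pow, norm_neg, norm_one, one_pow, one_mul, norm_div,
      Complex.norm_natCast, RCLike.norm_ofNat] at h2
    have h3 : ((l.choose (l / 2) : ℕ) : ℝ) = ((2 ^ l : ℕ) : ℝ) := by
      push_cast
      rw [one_div, inv_pow] at h2
      exact ((inv_mul_eq_one₀ (by positivity)).1 h2).symm
    exact (Nat.choose_lt_two_pow l (l / 2) hl).ne (Nat.cast_injective h3)
  · simp

variable {θ} in
/-- An invariant combination of words of length at most `k + 1` needs only shorter words. -/
theorem mem_wordSpan_of_invariant {k : ℕ} {x : A7 θ} (hx : x ∈ wordSpan θ (k + 1))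
    (hinv : ∀ w, alpha θ w x = x) : x ∈ wordSpan θ k := by
  -- Modulo shorter words the weight-zero words with given rows are all equal, so averaging the
  -- rotated word gives a scalar `c` times the word: the sum of the matrix entries of the rotation
  -- into weight zero.
  obtain ⟨c, hc, H⟩ : ∃ c : ℂ, c ≠ 1 ∧ ∀ (i : Fin (k + 1) → Fin 2) (I : Fin (k + 1) → Fin 4),
      2 * ones i = k + 1 →
      torusAvg θ (k + 1) (alpha θ rotElt (ketTensor θ i I)) - c • ketTensor θ i I ∈ wordSpan θ k := by
    by_cases hk : ∃ l, k + 1 = 2 * l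
    · obtain ⟨l, hl⟩ := hk
      refine ⟨_, coeff_expand_ne l (by omega), fun i I hi => ?_⟩
      have hsum : ∑ j : Fin (k + 1) → Fin 2, (if ones j = l then
          ∏ t, (rotElt : Matrix (Fin 2) (Fin 2) ℂ) (j t) (i t) else 0) =
          (Polynomial.C ((1 / 2 : ℂ) ^ l) *
            Polynomial.expand ℂ 2 ((Polynomial.X - Polynomial.C 1) ^ l)).coeff l := by
        rw [← coeff_prod_columns]
        congr 1
        have h1 : ones i = l := by omega
        -- The length `k + 1` occurs in the type of `i`, which has to be generalized before it can
        -- be rewritten as `2 * l`.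
        clear hi
        revert i
        rw [hl]
        exact fun i h => prod_columns_rotElt i h
      rw [← hsum, alpha_ketTensor, map_sum, Finset.sum_smul, ← Finset.sum_sub_distrib]
      refine sum_mem fun j _ => ?_
      rw [torusAvg_smul, torusAvg_ketTensor]
      by_cases hj : ones j = l
      · rw [if_pos (by omega), if_pos hj, ← smul_sub]
        exact smul_mem_wordSpan (ketTensor_sub_mem_wordSpan θ (by omega) I) _
      · rw [if_neg (by omega), if_neg hj]
        simp
    -- In odd length no word has weight zero, so the condition is vacuous.
    · exact ⟨0, zero_ne_one, fun i I hi => absurd ⟨_, hi.symm⟩ hk⟩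
  set p := torusAvg θ (k + 1) with hp
  have key : wordSpan θ (k + 1) ≤
      (wordSpan θ k).comap (p ∘ₗ alphaLin θ rotElt ∘ₗ p - c • p) := by
    refine Submodule.span_le.2 ?_
    rintro _ ⟨l, hl, rfl⟩
    change p (alpha θ rotElt (p (word θ l))) - c • p (word θ l) ∈ wordSpan θ k
    rcases hl.lt_or_eq with h | h
    · have h' := word_mem_wordSpan (θ := θ) (Nat.le_of_lt_succ h)
      exact sub_mem (torusAvg_mem_wordSpan _ (alpha_mem_wordSpan _ (torusAvg_mem_wordSpan _ h')))
        (smul_mem_wordSpan (torusAvg_mem_wordSpan _ h') c)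
    · obtain ⟨i, I, e⟩ : ∃ (i : Fin (k + 1) → Fin 2) (I : Fin (k + 1) → Fin 4),
          word θ l = ketTensor θ i I := by
        suffices ∀ m, l.length = m → ∃ (i : Fin m → Fin 2) (I : Fin m → Fin 4),
            word θ l = ketTensor θ i I from this _ h
        rintro _ rfl
        exact ⟨_, _, word_eq_ketTensor θ l⟩
      rw [e, hp, torusAvg_ketTensor]
      split_ifs with hi
      · exact H i I hi
      · simp
  -- On an invariant `x` both averages and the rotation act trivially, so this says that (1 - c)x is
  -- a combination of shorter words.
  have h1 : p (alpha θ rotElt (p x)) - c • p x ∈ wordSpan θ k := key hx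
  rw [torusAvg_of_invariant θ _ hinv, hinv, torusAvg_of_invariant θ _ hinv] at h1
  have h2 := smul_mem_wordSpan h1 (1 - c)⁻¹
  have h3 : x - c • x = (1 - c) • x := by module
  rwa [h3, smul_smul, inv_mul_cancel₀ (sub_ne_zero.2 hc.symm), one_smul] at h2

/-- The invariant elements of `A(S_{θ'}^7)` come from `A(S_θ^4)`. -/
theorem mem_base_of_invariant {x : A7 θ} (hinv : ∀ w, alpha θ w x = x) : x ∈ base θ := by
  obtain ⟨k, hk⟩ := exists_mem_wordSpan x
  induction k with
  | zero => exact wordSpan_zero hk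
  | succ k ih => exact ih (mem_wordSpan_of_invariant hk hinv)

end invariants

/-! ### Representations by Weyl operators, and injectivity of the Hopf map -/

section weyl

/-- The operator `f ↦ (k ↦ ω ^ (d.2 * k) * f (k + d.1))` on functions `ℤ → ℂ`. -/
def weylOp (ω : ℂ) (d : ℤ × ℤ) : Module.End ℂ (ℤ → ℂ) where
  toFun f k := ω ^ (d.2 * k) * f (k + d.1)
  map_add' f g := by ext k; simp [mul_add]
  map_smul' c f := by ext k; simp; ring

variable {ω : ℂ}

theorem weylOp_mul (hω : ω ≠ 0) (d d' : ℤ × ℤ) :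
    weylOp ω d * weylOp ω d' = ω ^ (d'.2 * d.1) • weylOp ω (d + d') := by
  ext f k
  simp only [weylOp, Module.End.mul_apply, LinearMap.coe_mk, AddHom.coe_mk, LinearMap.smul_apply,
    Pi.smul_apply, smul_eq_mul, Prod.fst_add, Prod.snd_add]
  rw [← mul_assoc, ← mul_assoc, ← zpow_add₀ hω, ← zpow_add₀ hω, add_assoc]
  congr 2
  ring

theorem weylOp_zero : weylOp ω 0 = 1 := by
  ext f k
  simp [weylOp]

theorem weylOp_comm (hω : ω ≠ 0) (d d' : ℤ × ℤ) :
    weylOp ω d * weylOp ω d' =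
      ω ^ (d'.2 * d.1 - d.2 * d'.1) • (weylOp ω d' * weylOp ω d) := by
  rw [weylOp_mul hω, weylOp_mul hω, smul_smul, ← zpow_add₀ hω, add_comm d', sub_add_cancel]

/-- Invertibility is what later guarantees that a product of Weyl operators has a nonzero matrix
entry. -/
theorem weylOp_isUnit (hω : ω ≠ 0) (d : ℤ × ℤ) : IsUnit (weylOp ω d) := by
  have h (d : ℤ × ℤ) : weylOp ω d * (ω ^ (d.2 * d.1) • weylOp ω (-d)) = 1 := by
    rw [mul_smul_comm, weylOp_mul hω, smul_smul, ← zpow_add₀ hω, add_neg_cancel, weylOp_zero,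
      Prod.snd_neg, neg_mul, add_neg_cancel, zpow_zero, one_smul]
  refine ⟨⟨_, _, h d, ?_⟩, rfl⟩
  -- The scalar depends on the product of the two components of `d`, which is unchanged under
  -- negation, so the identity at `-d` gives the other inverse.
  have := h (-d)
  rw [neg_neg, mul_smul_comm] at this
  rw [smul_mul_assoc]
  simpa using this

end weyl

/-! ### Representations of A(S^7) attached to points of S^7. -/

section rep

variable (θ : ℝ)

/-- The parameter of the Weyl operators. -/
def weylParam : ℂ := Complex.exp (-(Real.pi * Complex.I * θ))

theorem weylParam_ne_zero : weylParam θ ≠ 0 := Complex.exp_ne_zero _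

theorem star_weylParam : star (weylParam θ) = (weylParam θ)⁻¹ := by
  rw [weylParam, ← Complex.exp_neg, Complex.star_def, ← Complex.exp_conj]
  simp

/-- The degrees of the generators of `A(S_{θ'}^7)`. -/
def wt : Fin 4 → ℤ × ℤ := ![(1, 0), (-1, 0), (0, 1), (0, -1)]

/-- With the degrees `wt`, the deformation matrix θ' is a multiple of the standard symplectic form
on ℤ², which is exactly the commutation factor in `weylOp_comm`. -/
theorem phase_theta7 (a b : Fin 4) : phase (theta7 θ) a b =
    weylParam θ ^ ((wt b).2 * (wt a).1 - (wt a).2 * (wt b).1) := by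
  rw [phase, weylParam, ← Complex.exp_int_mul]
  congr 1
  fin_cases a <;> fin_cases b <;> simp [theta7, wt] <;> ring

/-- The image of the generators `ψ_a` and `ψ_a^*` under `weylRep`. -/
def weylLetter (p : Fin 4 → ℂ) (y : Fin 4 × Bool) : Module.End ℂ (ℤ → ℂ) :=
  if y.2 then star (p y.1) • weylOp (weylParam θ) (-wt y.1)
  else p y.1 • weylOp (weylParam θ) (wt y.1)

/-- The homomorphism from the free algebra inducing `weylRep`. -/
def weylFree (p : Fin 4 → ℂ) : FreeStarAlg (Fin 4) →ₐ[ℂ] Module.End ℂ (ℤ → ℂ) :=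
  FreeAlgebra.lift ℂ (weylLetter θ p)

theorem weylFree_gen (p : Fin 4 → ℂ) (a : Fin 4) :
    weylFree θ p (FreeStarAlg.gen a) = p a • weylOp (weylParam θ) (wt a) :=
  FreeAlgebra.lift_ι_apply _ _

theorem weylFree_star_gen (p : Fin 4 → ℂ) (a : Fin 4) :
    weylFree θ p (star (FreeStarAlg.gen a)) = star (p a) • weylOp (weylParam θ) (-wt a) := by
  rw [FreeStarAlg.gen, FreeStarAlg.star_letter]
  exact FreeAlgebra.lift_ι_apply _ _

theorem smul_weylOp_comm (c c' : ℂ) (d d' : ℤ × ℤ) {e : ℤ}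
    (he : e = d'.2 * d.1 - d.2 * d'.1) :
    (c • weylOp (weylParam θ) d) * (c' • weylOp (weylParam θ) d') =
      weylParam θ ^ e •
        ((c' • weylOp (weylParam θ) d') * (c • weylOp (weylParam θ) d)) := by
  simp only [smul_mul_assoc, mul_smul_comm]
  rw [weylOp_comm (weylParam_ne_zero θ), he]
  module

/-- The degrees lie on the coordinate axes, so the cocycle of `weylOp_mul` is trivial here. This
reduces the spherical relation to ∑ |p_a|² = 1. -/
theorem weylOp_neg_wt_mul (a : Fin 4) :
    weylOp (weylParam θ) (-wt a) * weylOp (weylParam θ) (wt a) = 1 := by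
  rw [weylOp_mul (weylParam_ne_zero θ), neg_add_cancel, weylOp_zero]
  fin_cases a <;> simp [wt]

/-- The target is treated as a plain algebra, so the adjoint relations are checked separately. They
hold because the Weyl parameter has modulus one, so that conjugating a phase inverts it. -/
theorem weylFree_rel (p : Fin 4 → ℂ) (hp : ∑ a, star (p a) * p a = 1) {x y : FreeStarAlg (Fin 4)}
    (h : StarClosure (SphereRel (theta7 θ)) x y) : weylFree θ p x = weylFree θ p y := by
  have hs : ∑ a, weylFree θ p (star (FreeStarAlg.gen a)) * weylFree θ p (FreeStarAlg.gen a) = 1 := by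
    simp only [weylFree_gen, weylFree_star_gen, smul_mul_assoc, mul_smul_comm, weylOp_neg_wt_mul,
      smul_smul, ← Finset.sum_smul]
    simp only [mul_comm (p _)]
    rw [hp, one_smul]
  have hst (e : ℤ) : star (weylParam θ ^ e) = weylParam θ ^ (-e) := by
    rw [star_zpow₀, star_weylParam, inv_zpow, zpow_neg]
  cases h with
  | of h =>
    cases h with
    | comm a b =>
      simp only [map_mul, map_smul, weylFree_gen, phase_theta7]
      exact smul_weylOp_comm θ _ _ _ _ rfl
    | comm_star a b =>
      simp only [map_mul, map_smul, weylFree_gen, weylFree_star_gen, phase_theta7]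
      exact smul_weylOp_comm θ _ _ _ _ (by simp; ring)
    | star_comm a b =>
      simp only [map_mul, map_smul, weylFree_star_gen, phase_theta7]
      exact smul_weylOp_comm θ _ _ _ _ (by simp)
    | sphere => simpa using hs
  | adj h =>
    cases h with
    | comm a b =>
      simp only [star_mul, star_smul, map_mul, map_smul, weylFree_star_gen, phase_theta7, hst]
      exact smul_weylOp_comm θ _ _ _ _ (by simp)
    | comm_star a b =>
      simp only [star_mul, star_smul, star_star, map_mul, map_smul, weylFree_gen,
        weylFree_star_gen, phase_theta7, hst]
      exact smul_weylOp_comm θ _ _ _ _ (by simp; ring)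
    | star_comm a b =>
      simp only [star_mul, star_smul, star_star, map_mul, map_smul, weylFree_gen, phase_theta7, hst]
      exact smul_weylOp_comm θ _ _ _ _ (by ring)
    | sphere => simpa using hs

/-- The representation of `A(S_{θ'}^7)` by Weyl operators attached to a point of `S^7`. -/
def weylRep (p : Fin 4 → ℂ) (hp : ∑ a, star (p a) * p a = 1) :
    A7 θ →ₐ[ℂ] Module.End ℂ (ℤ → ℂ) :=
  RingQuot.liftAlgHom ℂ ⟨weylFree θ p, fun _ _ h => weylFree_rel θ p hp h⟩

variable {p : Fin 4 → ℂ} (hp : ∑ a, star (p a) * p a = 1)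

theorem weylRep_psi (a : Fin 4) :
    weylRep θ p hp (psi θ a) = p a • weylOp (weylParam θ) (wt a) :=
  (RingQuot.liftAlgHom_mkAlgHom_apply ℂ _ _ _).trans (weylFree_gen θ p a)

theorem weylRep_star_psi (a : Fin 4) :
    weylRep θ p hp (star (psi θ a)) = star (p a) • weylOp (weylParam θ) (-wt a) := by
  rw [psi, PresStarAlg.gen, ← map_star]
  exact (RingQuot.liftAlgHom_mkAlgHom_apply ℂ _ _ _).trans (weylFree_star_gen θ p a)

end rep

/-! ### Representations of A(S^4) attached to points of S^4. -/

section pointRep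

variable (θ : ℝ)

/-- The images of `z_1, z_1^*, z_2, z_2^*`, up to scalars, under the representations `weylRep`. -/
def weylUnit : Fin 4 → Module.End ℂ (ℤ → ℂ) :=
  ![weylOp (weylParam θ) (1, 0) * weylOp (weylParam θ) (0, -1),
    weylOp (weylParam θ) (0, 1) * weylOp (weylParam θ) (-1, 0),
    weylOp (weylParam θ) (-1, 0) * weylOp (weylParam θ) (0, -1),
    weylOp (weylParam θ) (0, 1) * weylOp (weylParam θ) (1, 0)]

theorem weylUnit_isUnit (t : Fin 4) : IsUnit (weylUnit θ t) := by
  have h := weylOp_isUnit (weylParam_ne_zero θ)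
  fin_cases t <;> exact (h _).mul (h _)

/-- The generators `z_0, z_1, z_2` of `A(S_θ^4)`. -/
def zed (μ : Fin 3) : A4 θ := PresStarAlg.gen _ μ

/-- The elements `z_1, z_1^*, z_2, z_2^*`. -/
def zedLetter : Fin 4 → A4 θ := ![zed θ 1, star (zed θ 1), zed θ 2, star (zed θ 2)]

/-- The point of S^7 is given by a section of the classical Hopf fibration, defined away from the
pole q_0 = -1. -/
theorem exists_pointRep {q₀ : ℝ} {q₁ q₂ : ℂ}
    (hq : q₀ ^ 2 + Complex.normSq q₁ + Complex.normSq q₂ = 1) (h : -1 < q₀) :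
    ∃ χ : A4 θ →ₐ[ℂ] Module.End ℂ (ℤ → ℂ), (∀ y, hopf θ y = 0 → χ y = 0) ∧
      χ (zed θ 0) = (q₀ : ℂ) • 1 ∧
      ∀ t, χ (zedLetter θ t) = (![q₁, star q₁, q₂, star q₂] t) • weylUnit θ t := by
  obtain ⟨r, hr0, hr⟩ : ∃ r : ℝ, 0 < r ∧ 2 * r ^ 2 = 1 + q₀ :=
    ⟨Real.sqrt ((1 + q₀) / 2), Real.sqrt_pos.2 (by linarith), by
      rw [Real.sq_sqrt (by linarith)]; ring⟩
  have hrc : (r : ℂ) ≠ 0 := Complex.ofReal_ne_zero.2 hr0.ne'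
  have hq₀ : (q₀ : ℂ) = 2 * (r : ℂ) ^ 2 - 1 := by
    rw [show q₀ = 2 * r ^ 2 - 1 by linarith]; push_cast; ring
  have hqc : (2 * (r : ℂ) ^ 2 - 1) ^ 2 + q₁ * star q₁ + q₂ * star q₂ = 1 := by
    rw [← hq₀, Complex.star_def, Complex.mul_conj, Complex.mul_conj]
    exact_mod_cast hq
  have hsum : q₁ * star q₁ + q₂ * star q₂ = 4 * (r : ℂ) ^ 2 * (1 - (r : ℂ) ^ 2) := by
    linear_combination hqc
  -- With p_0 = r > 0 and p_1 = 0 the formulas for z_1 and z_2 become q_1 = 2 r p̄_2 and q_2 = -2 r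
  -- p_3; the value of z_0 requires 2r² = 1 + q_0.
  obtain ⟨p, hp0, hp1, hp2, hp3⟩ : ∃ p : Fin 4 → ℂ, p 0 = r ∧ p 1 = 0 ∧
      p 2 = star q₁ / (2 * r) ∧ p 3 = -q₂ / (2 * r) :=
    ⟨![r, 0, star q₁ / (2 * r), -q₂ / (2 * r)], rfl, rfl, rfl, rfl⟩
  have hs0 : star (p 0) = r := by rw [hp0]; exact Complex.conj_ofReal r
  have hs1 : star (p 1) = 0 := by rw [hp1, star_zero]
  have hs2 : star (p 2) = q₁ / (2 * r) := by rw [hp2]; simp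
  have hs3 : star (p 3) = -star q₂ / (2 * r) := by rw [hp3]; simp
  have h23 : star (p 2) * p 2 + star (p 3) * p 3 = 1 - (r : ℂ) ^ 2 := by
    rw [hs2, hs3, hp2, hp3]
    field_simp
    linear_combination hsum
  have hp : ∑ a, star (p a) * p a = 1 := by
    rw [Fin.sum_univ_four, add_assoc, h23, hs0, hp0, hp1]
    ring
  refine ⟨(weylRep θ p hp).comp (hopf θ : A4 θ →ₐ[ℂ] A7 θ), fun y hy => ?_, ?_, fun t => ?_⟩
  · change weylRep θ p hp (hopf θ y) = 0
    rw [hy, map_zero]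
  · change weylRep θ p hp (hopf θ (zed θ 0)) = _
    rw [zed, hopf_gen]
    simp only [hopfZ, Matrix.cons_val_zero, map_sub, map_add, map_mul, weylRep_psi,
      weylRep_star_psi, smul_mul_assoc, mul_smul_comm, weylOp_neg_wt_mul, smul_smul]
    rw [← add_smul, ← sub_smul, ← sub_smul, hq₀]
    congr 1
    rw [hs0, hp0, hp1]
    linear_combination -h23
  · have h1 : hopfZ θ 1 =
        (2 : ℂ) • (psi θ 0 * star (psi θ 2) + star (psi θ 1) * psi θ 3) := by
      rw [two_smul, ← two_mul]; rfl
    have h2 : hopfZ θ 2 =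
        (2 : ℂ) • (-(star (psi θ 0) * psi θ 3) + psi θ 1 * star (psi θ 2)) := by
      rw [two_smul, ← two_mul]; rfl
    have hz (t : Fin 4) : hopf θ (zedLetter θ t) =
        ![hopfZ θ 1, star (hopfZ θ 1), hopfZ θ 2, star (hopfZ θ 2)] t := by
      have hg (μ : Fin 3) : hopf θ (star (zed θ μ)) = star (hopfZ θ μ) :=
        (map_star (hopf θ) _).trans (congrArg star (hopf_gen θ μ))
      fin_cases t
      exacts [hopf_gen θ 1, hg 1, hopf_gen θ 2, hg 2]
    change weylRep θ p hp (hopf θ (zedLetter θ t)) = _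
    rw [hz, h1, h2]
    fin_cases t <;>
      simp only [Fin.zero_eta, Fin.mk_one, Fin.reduceFinMk, Matrix.cons_val, star_smul, star_mul,
        star_add, star_neg, star_star, star_ofNat, map_smul, map_mul, map_add, map_neg,
        weylRep_psi, weylRep_star_psi, hs0, hs1, hs2, hs3] <;>
      simp only [hp0, hp1, hp2, hp3, zero_smul, smul_zero, zero_mul, mul_zero, add_zero, weylUnit,
        smul_mul_assoc, mul_smul_comm, smul_smul, ← neg_smul, wt, Matrix.cons_val, Prod.neg_mk,
        neg_zero, neg_neg] <;>
      congr 1 <;> field_simp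

end pointRep

/-! ### Normal forms in A(S^4) and separation by the point representations. -/

section normalForm

variable (θ : ℝ)

theorem phase_ne_zero {m : ℕ} (Θ : Matrix (Fin m) (Fin m) ℝ) (a b : Fin m) : phase Θ a b ≠ 0 :=
  Complex.exp_ne_zero _

theorem mk_zed (μ : Fin 3) : PresStarAlg.mk (Sphere4Rel θ) (FreeStarAlg.gen μ) = zed θ μ := rfl

theorem zed_comm (a b : Fin 3) : zed θ a * zed θ b = phase (theta4 θ) a b • (zed θ b * zed θ a) := by
  have h := PresStarAlg.mk_rel (Sphere4Rel.of (SphereRel.comm (Θ := theta4 θ) a b))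
  simpa only [map_mul, map_smul, map_star, mk_zed] using h

theorem zed_comm_star (a b : Fin 3) :
    zed θ a * star (zed θ b) = phase (theta4 θ) b a • (star (zed θ b) * zed θ a) := by
  have h := PresStarAlg.mk_rel (Sphere4Rel.of (SphereRel.comm_star (Θ := theta4 θ) a b))
  simpa only [map_mul, map_smul, map_star, mk_zed] using h

theorem zed_star_comm (a b : Fin 3) : star (zed θ a) * star (zed θ b) =
    phase (theta4 θ) a b • (star (zed θ b) * star (zed θ a)) := by
  have h := PresStarAlg.mk_rel (Sphere4Rel.of (SphereRel.star_comm (Θ := theta4 θ) a b))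
  simpa only [map_mul, map_smul, map_star, mk_zed] using h

theorem star_zed_zero : star (zed θ 0) = zed θ 0 := by
  have h := PresStarAlg.mk_rel (Sphere4Rel.selfAdj (θ := θ))
  simpa only [map_star, mk_zed] using h

theorem zed_sphere : zed θ 0 * zed θ 0 + star (zed θ 1) * zed θ 1 + star (zed θ 2) * zed θ 2 = 1 := by
  have h := PresStarAlg.mk_rel (Sphere4Rel.of (SphereRel.sphere (Θ := theta4 θ)))
  simpa only [map_mul, map_add, map_star, map_one, mk_zed, Fin.sum_univ_three, star_zed_zero]
    using h

theorem star_zed_comm (a b : Fin 3) :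
    ∃ c : ℂ, star (zed θ a) * zed θ b = c • (zed θ b * star (zed θ a)) :=
  ⟨(phase (theta4 θ) a b)⁻¹, by
    rw [zed_comm_star, smul_smul, inv_mul_cancel₀ (phase_ne_zero _ _ _), one_smul]⟩

theorem zedLetter_comm (t u : Fin 4) :
    ∃ c : ℂ, zedLetter θ t * zedLetter θ u = c • (zedLetter θ u * zedLetter θ t) := by
  have h1 (a b : Fin 3) : ∃ c : ℂ, zed θ a * zed θ b = c • (zed θ b * zed θ a) := ⟨_, zed_comm θ a b⟩
  have h2 (a b : Fin 3) : ∃ c : ℂ, zed θ a * star (zed θ b) = c • (star (zed θ b) * zed θ a) :=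
    ⟨_, zed_comm_star θ a b⟩
  have h3 (a b : Fin 3) : ∃ c : ℂ, star (zed θ a) * star (zed θ b) =
      c • (star (zed θ b) * star (zed θ a)) := ⟨_, zed_star_comm θ a b⟩
  fin_cases t <;> fin_cases u <;>
    first | exact h1 _ _ | exact h2 _ _ | exact h3 _ _ | exact star_zed_comm θ _ _

theorem zedLetter_mul_pow (t u : Fin 4) (n : ℕ) : ∃ c : ℂ,
    zedLetter θ t * zedLetter θ u ^ n = c • (zedLetter θ u ^ n * zedLetter θ t) := by
  obtain ⟨c, hc⟩ := zedLetter_comm θ t u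
  induction n with
  | zero => exact ⟨1, by simp⟩
  | succ n ih =>
    obtain ⟨d, hd⟩ := ih
    exact ⟨d * c, by rw [pow_succ, ← mul_assoc, hd, smul_mul_assoc, mul_assoc, hc, mul_smul_comm,
      smul_smul, mul_assoc]⟩

theorem zedLetter_comm_zed_zero (t : Fin 4) : zedLetter θ t * zed θ 0 = zed θ 0 * zedLetter θ t := by
  have hp (a b : Fin 3) (h : theta4 θ a b = 0) : phase (theta4 θ) a b = 1 := by simp [phase, h]
  have h1 : zed θ 1 * zed θ 0 = zed θ 0 * zed θ 1 := by
    rw [zed_comm, hp _ _ (by simp [theta4]), one_smul]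
  have h2 : zed θ 2 * zed θ 0 = zed θ 0 * zed θ 2 := by
    rw [zed_comm, hp _ _ (by simp [theta4]), one_smul]
  fin_cases t
  · exact h1
  · simpa [star_zed_zero, zedLetter] using (congrArg star h1).symm
  · exact h2
  · simpa [star_zed_zero, zedLetter] using (congrArg star h2).symm

/-- The ordered monomial in `z_1, z_1^*, z_2, z_2^*` with the given exponents. -/
def zedMon (s : Fin 4 →₀ ℕ) : A4 θ :=
  zedLetter θ 0 ^ s 0 * zedLetter θ 1 ^ s 1 * zedLetter θ 2 ^ s 2 * zedLetter θ 3 ^ s 3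

/-- The linear map sending commutative monomials to ordered monomials. -/
def zedPoly : MvPolynomial (Fin 4) ℂ →ₗ[ℂ] A4 θ :=
  (MvPolynomial.basisMonomials (Fin 4) ℂ).constr ℂ (zedMon θ)

theorem zedPoly_monomial (s : Fin 4 →₀ ℕ) (c : ℂ) :
    zedPoly θ (MvPolynomial.monomial s c) = c • zedMon θ s := by
  have h : zedPoly θ (MvPolynomial.monomial s 1) = zedMon θ s := by
    have := (MvPolynomial.basisMonomials (Fin 4) ℂ).constr_basis ℂ (zedMon θ) s
    rwa [MvPolynomial.coe_basisMonomials] at this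
  rw [← h, ← map_smul, MvPolynomial.smul_monomial, smul_eq_mul, mul_one]

theorem zedLetter_mul_zedMon (t : Fin 4) (s : Fin 4 →₀ ℕ) :
    ∃ c : ℂ, zedLetter θ t * zedMon θ s = c • zedMon θ (s + Finsupp.single t 1) := by
  obtain ⟨c0, h0⟩ := zedLetter_mul_pow θ t 0 (s 0)
  obtain ⟨c1, h1⟩ := zedLetter_mul_pow θ t 1 (s 1)
  obtain ⟨c2, h2⟩ := zedLetter_mul_pow θ t 2 (s 2)
  have e0 (x : A4 θ) := congrArg (· * x) h0
  have e1 (x : A4 θ) := congrArg (· * x) h1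
  have e2 (x : A4 θ) := congrArg (· * x) h2
  simp only [mul_assoc, smul_mul_assoc] at e0 e1 e2
  unfold zedMon
  fin_cases t
  · refine ⟨1, ?_⟩
    simp [pow_succ', mul_assoc]
  · refine ⟨c0, ?_⟩
    simp only [mul_assoc]
    rw [e0]
    simp [pow_succ', mul_assoc]
  · refine ⟨c0 * c1, ?_⟩
    simp only [mul_assoc]
    rw [e0, e1]
    simp [pow_succ', mul_assoc, smul_smul]
  · refine ⟨c0 * c1 * c2, ?_⟩
    simp only [mul_assoc]
    rw [e0, e1, e2]
    simp [pow_succ', smul_smul]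

theorem zedLetter_mul_mem_range (t : Fin 4) {x : A4 θ} (hx : x ∈ LinearMap.range (zedPoly θ)) :
    zedLetter θ t * x ∈ LinearMap.range (zedPoly θ) := by
  obtain ⟨f, rfl⟩ := hx
  induction f using MvPolynomial.induction_on' with
  | monomial s a =>
    obtain ⟨c, hc⟩ := zedLetter_mul_zedMon θ t s
    exact ⟨MvPolynomial.monomial (s + Finsupp.single t 1) (a * c), by
      rw [zedPoly_monomial, zedPoly_monomial, mul_smul_comm, hc, smul_smul]⟩
  | add p q hp hq =>
    rw [map_add, mul_add]
    exact add_mem hp hq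

/-- Reordering the letters costs only phases, z_0 commutes with all of them, and the spherical
relation eliminates z_0². So the set of such sums is stable under left multiplication by every
generator and contains 1. -/
theorem exists_normalForm (y : A4 θ) : ∃ u ∈ LinearMap.range (zedPoly θ),
    ∃ v ∈ LinearMap.range (zedPoly θ), y = u + zed θ 0 * v := by
  suffices H : ∀ (x : FreeStarAlg (Fin 3)) (y : A4 θ),
      (∃ u ∈ LinearMap.range (zedPoly θ), ∃ v ∈ LinearMap.range (zedPoly θ), y = u + zed θ 0 * v) →
      ∃ u ∈ LinearMap.range (zedPoly θ), ∃ v ∈ LinearMap.range (zedPoly θ),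
        PresStarAlg.mk _ x * y = u + zed θ 0 * v by
    obtain ⟨x, rfl⟩ := PresStarAlg.mk_surjective y
    rw [← mul_one (PresStarAlg.mk _ x)]
    refine H x 1 ⟨1, ⟨MvPolynomial.monomial 0 1, ?_⟩, 0, zero_mem _, by simp⟩
    rw [zedPoly_monomial]
    simp [zedMon]
  have h0 (y : A4 θ) : (∃ u ∈ LinearMap.range (zedPoly θ), ∃ v ∈ LinearMap.range (zedPoly θ),
      y = u + zed θ 0 * v) → ∃ u ∈ LinearMap.range (zedPoly θ), ∃ v ∈ LinearMap.range (zedPoly θ),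
      zed θ 0 * y = u + zed θ 0 * v := by
    rintro ⟨u, hu, v, hv, rfl⟩
    have e : zed θ 0 * zed θ 0 = 1 - zedLetter θ 1 * zedLetter θ 0 - zedLetter θ 3 * zedLetter θ 2 := by
      rw [← zed_sphere θ]
      simp [zedLetter]
      abel
    refine ⟨v - zedLetter θ 1 * (zedLetter θ 0 * v) - zedLetter θ 3 * (zedLetter θ 2 * v),
      sub_mem (sub_mem hv ?_) ?_, u, hu, ?_⟩
    · exact zedLetter_mul_mem_range θ _ (zedLetter_mul_mem_range θ _ hv)
    · exact zedLetter_mul_mem_range θ _ (zedLetter_mul_mem_range θ _ hv)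
    · rw [mul_add, ← mul_assoc (zed θ 0), e]
      noncomm_ring
  have ht (t : Fin 4) (y : A4 θ) : (∃ u ∈ LinearMap.range (zedPoly θ),
      ∃ v ∈ LinearMap.range (zedPoly θ), y = u + zed θ 0 * v) →
      ∃ u ∈ LinearMap.range (zedPoly θ), ∃ v ∈ LinearMap.range (zedPoly θ),
      zedLetter θ t * y = u + zed θ 0 * v := by
    rintro ⟨u, hu, v, hv, rfl⟩
    exact ⟨_, zedLetter_mul_mem_range θ t hu, _, zedLetter_mul_mem_range θ t hv, by
      rw [mul_add, ← mul_assoc, zedLetter_comm_zed_zero, mul_assoc]⟩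
  intro x
  induction x using FreeStarAlg.induct with
  | h0 c =>
    rintro _ ⟨u, hu, v, hv, rfl⟩
    refine ⟨c • u, Submodule.smul_mem _ c hu, c • v, Submodule.smul_mem _ c hv, ?_⟩
    rw [AlgHomClass.commutes, ← Algebra.smul_def, smul_add, mul_smul_comm]
  | h1 x =>
    obtain ⟨μ, _ | _⟩ := x
    · fin_cases μ
      exacts [h0, ht 0, ht 2]
    · have e : PresStarAlg.mk (Sphere4Rel θ) (FreeStarAlg.letter (μ, true)) = star (zed θ μ) := by
        rw [← mk_zed, ← map_star, FreeStarAlg.gen, FreeStarAlg.star_letter]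
        rfl
      rw [e]
      fin_cases μ
      · simpa only [Fin.zero_eta, star_zed_zero] using h0
      · exact ht 1
      · exact ht 3
  | h2 a b ha hb =>
    intro y hy
    rw [map_mul, mul_assoc]
    exact ha _ (hb _ hy)
  | h3 a b ha hb =>
    intro y hy
    obtain ⟨u, hu, v, hv, e⟩ := ha y hy
    obtain ⟨u', hu', v', hv', e'⟩ := hb y hy
    exact ⟨u + u', add_mem hu hu', v + v', add_mem hv hv', by
      rw [map_add, add_mul, e, e', mul_add]; abel⟩

/-- A polynomial in `q_1, q̄_1, q_2, q̄_2` that vanishes on a punctured ball is zero. -/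
theorem eq_zero_of_eval_conj {F : MvPolynomial (Fin 4) ℂ}
    (h : ∀ q₁ q₂ : ℂ, 0 < Complex.normSq q₁ + Complex.normSq q₂ →
      Complex.normSq q₁ + Complex.normSq q₂ < 1 →
      MvPolynomial.eval ![q₁, star q₁, q₂, star q₂] F = 0) : F = 0 := by
  -- Real and imaginary parts as new variables: conjugate pairs become independent real coordinates.
  let σ : Fin 4 → MvPolynomial (Fin 4) ℂ := ![.X 0 + .C Complex.I * .X 1,
    .X 0 - .C Complex.I * .X 1, .X 2 + .C Complex.I * .X 3, .X 2 - .C Complex.I * .X 3]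
  have hσ (x : Fin 4 → ℂ) : MvPolynomial.eval x (MvPolynomial.bind₁ σ F) =
      MvPolynomial.eval ![x 0 + Complex.I * x 1, x 0 - Complex.I * x 1, x 2 + Complex.I * x 3,
        x 2 - Complex.I * x 3] F := by
    rw [MvPolynomial.eval, MvPolynomial.eval₂Hom_bind₁]
    congr 2
    funext t
    fin_cases t <;> simp [σ]
  have h0 : MvPolynomial.bind₁ σ F = 0 := by
    -- Vanishing on a product of infinite sets suffices. Four coordinates in (0, 1/2) have squares
    -- with sum strictly between 0 and 1, so the point lies in the punctured ball.
    refine MvPolynomial.funext_set (fun _ => (fun r : ℝ => (r : ℂ)) '' Set.Ioo 0 (1 / 2))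
      (fun _ => (Set.Ioo_infinite (by norm_num)).image Complex.ofReal_injective.injOn) ?_
    intro x hx
    choose r hr hrx using fun t => hx t trivial
    have e (a b : Fin 4) : star (x a + Complex.I * x b) = x a - Complex.I * x b := by
      rw [← hrx a, ← hrx b]
      simp [sub_eq_add_neg]
    rw [hσ, map_zero, ← e 0 1, ← e 2 3]
    have hn (a b : Fin 4) : Complex.normSq (x a + Complex.I * x b) = r a ^ 2 + r b ^ 2 := by
      rw [← hrx a, ← hrx b, Complex.normSq_apply]
      simp
      ring
    have hb (a : Fin 4) : r a ^ 2 < 1 / 4 := by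
      have := hr a
      have h1 := this.1
      have h2 := this.2
      nlinarith
    refine h _ _ ?_ ?_ <;> rw [hn, hn]
    · have := (hr 0).1
      positivity
    · linarith [hb 0, hb 1, hb 2, hb 3]
  refine MvPolynomial.funext fun y => ?_
  -- The inverse of the substitution σ, now at arbitrary complex values.
  have := hσ ![(y 0 + y 1) / 2, (y 0 - y 1) / (2 * Complex.I), (y 2 + y 3) / 2,
    (y 2 - y 3) / (2 * Complex.I)]
  rw [h0, map_zero] at this
  rw [map_zero, this]
  congr 2
  funext t
  have hI := Complex.I_ne_zero
  fin_cases t <;> simp <;> field_simp <;> ring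

/-- The product of operators `weylUnit` corresponding to `zedMon`. -/
def weylMon (s : Fin 4 →₀ ℕ) : Module.End ℂ (ℤ → ℂ) :=
  weylUnit θ 0 ^ s 0 * weylUnit θ 1 ^ s 1 * weylUnit θ 2 ^ s 2 * weylUnit θ 3 ^ s 3

theorem weylMon_isUnit (s : Fin 4 →₀ ℕ) : IsUnit (weylMon θ s) := by
  have h (t : Fin 4) := (weylUnit_isUnit θ t).pow (s t)
  exact (((h 0).mul (h 1)).mul (h 2)).mul (h 3)

/-- Multiplication of the coefficients of a polynomial by matrix entries of `weylMon`. -/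
def weylCoeff (v : ℤ → ℂ) (k : ℤ) : MvPolynomial (Fin 4) ℂ →ₗ[ℂ] MvPolynomial (Fin 4) ℂ :=
  (MvPolynomial.basisMonomials (Fin 4) ℂ).constr ℂ
    fun s => MvPolynomial.monomial s (weylMon θ s v k)

theorem weylCoeff_monomial (v : ℤ → ℂ) (k : ℤ) (s : Fin 4 →₀ ℕ) (c : ℂ) :
    weylCoeff θ v k (MvPolynomial.monomial s c) =
      MvPolynomial.monomial s (c * weylMon θ s v k) := by
  have h : weylCoeff θ v k (MvPolynomial.monomial s 1) =
      MvPolynomial.monomial s (weylMon θ s v k) := by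
    have := (MvPolynomial.basisMonomials (Fin 4) ℂ).constr_basis ℂ
      (fun s => MvPolynomial.monomial s (weylMon θ s v k)) s
    rwa [MvPolynomial.coe_basisMonomials] at this
  rw [← smul_eq_mul c, ← MvPolynomial.smul_monomial, ← h, ← map_smul, MvPolynomial.smul_monomial,
    smul_eq_mul, mul_one]

theorem coeff_weylCoeff (v : ℤ → ℂ) (k : ℤ) (s : Fin 4 →₀ ℕ) (f : MvPolynomial (Fin 4) ℂ) :
    (weylCoeff θ v k f).coeff s = f.coeff s * weylMon θ s v k := by
  induction f using MvPolynomial.induction_on' with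
  | monomial s' a =>
    rw [weylCoeff_monomial, MvPolynomial.coeff_monomial, MvPolynomial.coeff_monomial]
    split_ifs with h
    · rw [h]
    · simp
  | add p q hp hq => rw [map_add, MvPolynomial.coeff_add, hp, hq, MvPolynomial.coeff_add, add_mul]

/-- Each monomial is multiplied by a matrix entry of an invertible operator, and some entry of it is
nonzero. Monomials are treated one by one, so linear independence of the operators is not needed. -/
theorem eq_zero_of_weylCoeff {f : MvPolynomial (Fin 4) ℂ}
    (h : ∀ v k, weylCoeff θ v k f = 0) : f = 0 := by
  ext s
  have h1 : weylMon θ s ≠ 0 := (weylMon_isUnit θ s).ne_zero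
  obtain ⟨v, hv⟩ : ∃ v, weylMon θ s v ≠ 0 := by
    by_contra! hc
    exact h1 (LinearMap.ext hc)
  obtain ⟨k, hk⟩ := Function.ne_iff.1 hv
  have := coeff_weylCoeff θ v k s f
  rw [h, MvPolynomial.coeff_zero] at this
  rw [MvPolynomial.coeff_zero]
  exact (mul_eq_zero.1 this.symm).resolve_right hk

/-- A matrix entry of the image of an ordered monomial is the commutative monomial in `q` times a
constant independent of `q`. An operator identity thus becomes a family of polynomial identities in
`q`. -/
theorem pointRep_zedPoly {q : Fin 4 → ℂ} (χ : A4 θ →ₐ[ℂ] Module.End ℂ (ℤ → ℂ))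
    (hχ : ∀ t, χ (zedLetter θ t) = q t • weylUnit θ t) (v : ℤ → ℂ) (k : ℤ)
    (f : MvPolynomial (Fin 4) ℂ) :
    χ (zedPoly θ f) v k = MvPolynomial.eval q (weylCoeff θ v k f) := by
  induction f using MvPolynomial.induction_on' with
  | monomial s a =>
    have h : χ (zedMon θ s) = (∏ t, q t ^ s t) • weylMon θ s := by
      simp only [zedMon, map_mul, map_pow, hχ, smul_pow, smul_mul_assoc, mul_smul_comm, smul_smul,
        weylMon, Fin.prod_univ_four]
      congr 1
      ring
    rw [zedPoly_monomial, weylCoeff_monomial, MvPolynomial.eval_monomial, map_smul, h,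
      Finsupp.prod_fintype _ _ (by simp)]
    simp only [LinearMap.smul_apply, Pi.smul_apply, smul_eq_mul]
    ring
  | add p q hp hq =>
    simp only [map_add, LinearMap.add_apply, Pi.add_apply, hp, hq]

/-- The Hopf map `A(S_θ^4) → A(S_{θ'}^7)` is injective. -/
theorem hopf_injective : Function.Injective (hopf θ) := by
  rw [injective_iff_map_eq_zero]
  intro y hy
  obtain ⟨_, ⟨f, rfl⟩, _, ⟨g, rfl⟩, rfl⟩ := exists_normalForm θ y
  have key (v : ℤ → ℂ) (k : ℤ) (q₀ : ℝ) (q₁ q₂ : ℂ)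
      (hq : q₀ ^ 2 + Complex.normSq q₁ + Complex.normSq q₂ = 1) (h : -1 < q₀) :
      MvPolynomial.eval ![q₁, star q₁, q₂, star q₂] (weylCoeff θ v k f) +
        q₀ * MvPolynomial.eval ![q₁, star q₁, q₂, star q₂] (weylCoeff θ v k g) = 0 := by
    obtain ⟨χ, h0, h1, h2⟩ := exists_pointRep θ hq h
    have h3 := congrFun (LinearMap.congr_fun (h0 _ hy) v) k
    rw [map_add, map_mul, h1, smul_mul_assoc, one_mul] at h3
    simp only [LinearMap.add_apply, LinearMap.smul_apply, Pi.add_apply, Pi.smul_apply, smul_eq_mul,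
      pointRep_zedPoly θ χ h2] at h3
    exact h3
  have key2 (v : ℤ → ℂ) (k : ℤ) (q₁ q₂ : ℂ) (hq' : 0 < Complex.normSq q₁ + Complex.normSq q₂)
      (hq : Complex.normSq q₁ + Complex.normSq q₂ < 1) :
      MvPolynomial.eval ![q₁, star q₁, q₂, star q₂] (weylCoeff θ v k f) = 0 ∧
        MvPolynomial.eval ![q₁, star q₁, q₂, star q₂] (weylCoeff θ v k g) = 0 := by
    set r := Real.sqrt (1 - Complex.normSq q₁ - Complex.normSq q₂) with hr
    have hr0 : 0 < r := Real.sqrt_pos.2 (by linarith)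
    have hr2 : r ^ 2 = 1 - Complex.normSq q₁ - Complex.normSq q₂ := Real.sq_sqrt (by linarith)
    have hc : (r : ℂ) ≠ 0 := Complex.ofReal_ne_zero.2 hr0.ne'
    have e1 := key v k r q₁ q₂ (by rw [hr2]; ring) (by linarith)
    -- The two points with opposite q_0 separate `f` from `g`. Positivity of |q_1|² + |q_2|² gives r
    -- < 1, which keeps `-r` away from the excluded pole.
    have e2 := key v k (-r) q₁ q₂ (by rw [neg_sq, hr2]; ring) (by nlinarith)
    push_cast at e2
    refine ⟨by linear_combination (e1 + e2) / 2, ?_⟩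
    have : (r : ℂ) * MvPolynomial.eval ![q₁, star q₁, q₂, star q₂] (weylCoeff θ v k g) = 0 := by
      linear_combination (e1 - e2) / 2
    exact (mul_eq_zero.1 this).resolve_left hc
  have hf : f = 0 := eq_zero_of_weylCoeff θ fun v k =>
    eq_zero_of_eval_conj fun q₁ q₂ hq' hq => (key2 v k q₁ q₂ hq' hq).1
  have hg : g = 0 := eq_zero_of_weylCoeff θ fun v k =>
    eq_zero_of_eval_conj fun q₁ q₂ hq' hq => (key2 v k q₁ q₂ hq' hq).2
  simp [hf, hg]

end normalForm

/-! ### Symmetric tensors -/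

section symmetric

variable {n : ℕ}

theorem mem_arrangements {k : ℕ} {i : Fin n → Fin 2} : i ∈ arrangements n k ↔ ones i = k := by
  simp [arrangements, ones]

theorem card_arrangements (n k : ℕ) : (arrangements n k).card = n.choose k := by
  have h : (arrangements n k).card = ((Finset.univ : Finset (Fin n)).powersetCard k).card := by
    refine Finset.card_nbij' (fun i => Finset.univ.filter fun t => i t = 1)
      (fun s t => if t ∈ s then 1 else 0) ?_ ?_ ?_ ?_
    · intro i hi
      simpa [Finset.mem_powersetCard, arrangements] using hi
    · intro s hs
      simpa [Finset.mem_powersetCard, arrangements] using hs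
    · intro i _
      funext t
      simp only [Finset.mem_filter, Finset.mem_univ, true_and]
      generalize i t = x
      fin_cases x <;> rfl
    · intro s _
      ext t
      simp
  rw [h, Finset.card_powersetCard, Finset.card_fin]

/-- A bijection between the positions of the ones extends to a permutation of all positions. -/
theorem apply_eq_of_ones_eq {u : (Fin n → Fin 2) → ℂ} (hu : u ∈ SymPow n) {i j : Fin n → Fin 2}
    (h : ones i = ones j) : u i = u j := by
  have e : {t // i t = 1} ≃ {t // j t = 1} := Fintype.equivOfCardEq (by
    rw [Fintype.card_subtype, Fintype.card_subtype]; exact h)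
  have hσ : j ∘ e.extendSubtype = i := by
    funext t
    by_cases ht : i t = 1
    · rw [ht]; exact e.extendSubtype_mem t ht
    · have h1 := e.extendSubtype_not_mem t ht
      have h2 (x : Fin 2) (hx : ¬ x = 1) : x = 0 := by omega
      rw [h2 _ ht]; exact h2 _ h1
  rw [← hσ, hu]

/-- The coordinates of the basis vector `symBasis n k`. -/
def symCoord (k : Fin (n + 1)) (i : Fin n → Fin 2) : ℂ := (symBasis n k : (Fin n → Fin 2) → ℂ) i

theorem symCoord_eq (k : Fin (n + 1)) (i : Fin n → Fin 2) : symCoord k i =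
    if ones i = k then ((Real.sqrt (n.choose k) : ℝ) : ℂ)⁻¹ else 0 := by
  simp [symCoord, symBasis, mem_arrangements]

theorem star_symCoord (k : Fin (n + 1)) (i : Fin n → Fin 2) :
    star (symCoord k i) = symCoord k i := by
  rw [symCoord_eq]
  split_ifs <;> simp

theorem choose_mul_inv_sqrt (k : Fin (n + 1)) :
    (n.choose k : ℂ) * (((Real.sqrt (n.choose k) : ℝ) : ℂ)⁻¹ *
      ((Real.sqrt (n.choose k) : ℝ) : ℂ)⁻¹) = 1 := by
  have h : 0 < n.choose k := Nat.choose_pos (Nat.le_of_lt_succ k.2)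
  rw [← mul_inv, ← Complex.ofReal_mul, Real.mul_self_sqrt (by positivity)]
  simp [h.ne']

/-- Only the weight of `i` contributes, and `u` is constant on the `n.choose k` arrangements of that
weight; the normalization cancels this number. -/
theorem sum_symCoord_mul {u : (Fin n → Fin 2) → ℂ} (hu : u ∈ SymPow n) (i : Fin n → Fin 2) :
    ∑ k, symCoord k i * ∑ j, symCoord k j * u j = u i := by
  have hlt : ones i < n + 1 := Nat.lt_succ_of_le (ones_le i)
  rw [Finset.sum_eq_single ⟨ones i, hlt⟩]
  · have h1 (j : Fin n → Fin 2) : symCoord ⟨ones i, hlt⟩ j * u j =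
        if j ∈ arrangements n (ones i) then
          ((Real.sqrt (n.choose (ones i)) : ℝ) : ℂ)⁻¹ * u i else 0 := by
      simp only [symCoord_eq, mem_arrangements]
      split_ifs with h
      · rw [apply_eq_of_ones_eq hu h]
      · exact zero_mul _
    simp only [h1]
    rw [Finset.sum_ite_mem, Finset.univ_inter, Finset.sum_const, card_arrangements, symCoord_eq,
      if_pos rfl, nsmul_eq_mul]
    linear_combination u i * choose_mul_inv_sqrt (⟨ones i, hlt⟩ : Fin (n + 1))
  · intro k _ hk
    rw [symCoord_eq, if_neg, zero_mul]
    rintro h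
    exact hk (Fin.ext h.symm)
  · simp

theorem sum_symCoord_mul_symCoord (k l : Fin (n + 1)) :
    ∑ i, symCoord k i * symCoord l i = if k = l then 1 else 0 := by
  have h1 (j : Fin n → Fin 2) : symCoord k j * symCoord l j =
      if j ∈ arrangements n k then (if k = l then ((Real.sqrt (n.choose k) : ℝ) : ℂ)⁻¹ *
        ((Real.sqrt (n.choose k) : ℝ) : ℂ)⁻¹ else 0) else 0 := by
    simp only [symCoord_eq, mem_arrangements]
    by_cases h : ones j = k
    · rw [if_pos h, if_pos h]
      by_cases hkl : k = l
      · rw [if_pos hkl, if_pos (hkl ▸ h), hkl]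
      · rw [if_neg hkl, if_neg (fun h' => hkl (Fin.ext (h.symm.trans h'))), mul_zero]
    · rw [if_neg h, if_neg h, zero_mul]
  simp only [h1]
  rw [Finset.sum_ite_mem, Finset.univ_inter, Finset.sum_const, card_arrangements, nsmul_eq_mul]
  split_ifs
  · exact choose_mul_inv_sqrt k
  · exact mul_zero _

/-- The matrix of the projection onto symmetric tensors. -/
def symProj (n : ℕ) : Matrix (Fin n → Fin 2) (Fin n → Fin 2) ℂ :=
  Matrix.of fun i j => ∑ k : Fin (n + 1), symCoord k i * symCoord k j

theorem symProj_mulVec {u : (Fin n → Fin 2) → ℂ} (hu : u ∈ SymPow n) : (symProj n).mulVec u = u := by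
  funext i
  rw [← sum_symCoord_mul hu i]
  simp only [Matrix.mulVec, dotProduct, symProj, Matrix.of_apply, Finset.sum_mul, Finset.mul_sum]
  rw [Finset.sum_comm]
  simp only [mul_assoc]

theorem symProj_conjTranspose : (symProj n).conjTranspose = symProj n := by
  ext i j
  simp only [Matrix.conjTranspose_apply, symProj, Matrix.of_apply, star_sum, star_mul',
    star_symCoord, mul_comm]

theorem symProj_col_mem (j : Fin n → Fin 2) : (fun i => symProj n i j) ∈ SymPow n := by
  have : (fun i => symProj n i j) = ∑ k : Fin (n + 1), symCoord k j • (symBasis n k).1 := by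
    funext i
    simp [symProj, symCoord, mul_comm]
  rw [this]
  exact sum_mem fun k _ => Submodule.smul_mem _ _ (symBasis n k).2

/-- The matrix of `w ⊗ ⋯ ⊗ w`. -/
def tensorMat (n : ℕ) (w : Matrix (Fin 2) (Fin 2) ℂ) : Matrix (Fin n → Fin 2) (Fin n → Fin 2) ℂ :=
  Matrix.of fun i j => ∏ t, w (i t) (j t)

theorem tensorMat_mulVec (w : Matrix (Fin 2) (Fin 2) ℂ) (v : (Fin n → Fin 2) → ℂ) :
    (tensorMat n w).mulVec v = tensorOp n w v := by
  rw [tensorOp, Matrix.toLin'_apply]; rfl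

theorem symProj_mul_tensorMat_mul_symProj (w : Matrix (Fin 2) (Fin 2) ℂ) :
    symProj n * (tensorMat n w * symProj n) = tensorMat n w * symProj n := by
  ext i j
  have h1 : (fun i => (tensorMat n w * symProj n) i j) ∈ SymPow n := by
    have := tensorOp_mem n w (symProj_col_mem (n := n) j)
    rwa [← tensorMat_mulVec] at this
  exact congrFun (symProj_mulVec h1) i

theorem coe_inv_SU2 (w : SU2) : ((w⁻¹ : SU2) : Matrix (Fin 2) (Fin 2) ℂ) =
    (w : Matrix (Fin 2) (Fin 2) ℂ).conjTranspose := rfl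

theorem tensorMat_conjTranspose (w : SU2) :
    (tensorMat n (w : Matrix (Fin 2) (Fin 2) ℂ)).conjTranspose =
      tensorMat n ((w⁻¹ : SU2) : Matrix (Fin 2) (Fin 2) ℂ) := by
  ext i j
  simp only [Matrix.conjTranspose_apply, tensorMat, Matrix.of_apply, star_prod, coe_inv_SU2]

/-- Write E for the projection and T for w ⊗ ⋯ ⊗ w. Stability of symmetric tensors gives ETE = TE
for every w; the adjoint of this, together with the same identity for w⁻¹, gives commutation because
T^* belongs to w⁻¹. -/
theorem symProj_mul_tensorMat (w : SU2) :
    symProj n * tensorMat n ((w⁻¹ : SU2) : Matrix (Fin 2) (Fin 2) ℂ) =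
      tensorMat n ((w⁻¹ : SU2) : Matrix (Fin 2) (Fin 2) ℂ) * symProj n := by
  have h := congrArg Matrix.conjTranspose
    (symProj_mul_tensorMat_mul_symProj (n := n) (w : Matrix (Fin 2) (Fin 2) ℂ))
  rw [Matrix.conjTranspose_mul, Matrix.conjTranspose_mul, symProj_conjTranspose,
    tensorMat_conjTranspose, mul_assoc, symProj_mul_tensorMat_mul_symProj] at h
  exact h.symm

theorem tensorMat_mul_inv (w : SU2) : tensorMat n (w : Matrix (Fin 2) (Fin 2) ℂ) *
    tensorMat n ((w⁻¹ : SU2) : Matrix (Fin 2) (Fin 2) ℂ) = 1 := by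
  have hw : (w : Matrix (Fin 2) (Fin 2) ℂ) * ((w⁻¹ : SU2) : Matrix (Fin 2) (Fin 2) ℂ) = 1 :=
    congrArg Subtype.val (mul_inv_cancel w)
  ext i j
  rw [Matrix.mul_apply]
  simp only [tensorMat, Matrix.of_apply, ← Finset.prod_mul_distrib]
  rw [← Fintype.piFinset_univ, ← Finset.prod_univ_sum (fun _ => Finset.univ)
    fun t b => (w : Matrix (Fin 2) (Fin 2) ℂ) (i t) b *
      ((w⁻¹ : SU2) : Matrix (Fin 2) (Fin 2) ℂ) b (j t)]
  simp only [← Matrix.mul_apply, hw, Matrix.one_apply, Finset.prod_ite_zero, Finset.prod_const_one,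
    Finset.mem_univ, true_imp_iff, funext_iff]

end symmetric

/-! ### Orthonormality -/

section braket

variable (θ : ℝ) {n : ℕ}

/-- The star reverses products, so the two first tensor factors meet in the middle, where Ψ^*Ψ = 1
applies; no commutation is required. -/
theorem braket_ketTensor (i j : Fin n → Fin 2) :
    braket (ketTensor θ i) (ketTensor θ j) = if i = j then 1 else 0 := by
  induction n with
  | zero => simp [braket, ketTensor, Subsingleton.elim i j]
  | succ n ih =>
    have h : braket (ketTensor θ i) (ketTensor θ j) =
        ∑ I, star (ketTensor θ (Fin.tail i) I) *
          ((∑ a, star (Psi θ a (i 0)) * Psi θ a (j 0)) * ketTensor θ (Fin.tail j) I) := by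
      rw [braket, ← (Fin.consEquiv fun _ => Fin 4).sum_comp, Fintype.sum_prod_type,
        Finset.sum_comm]
      refine Finset.sum_congr rfl fun I _ => ?_
      rw [Finset.sum_mul, Finset.mul_sum]
      refine Finset.sum_congr rfl fun a _ => ?_
      simp [Fin.consEquiv, ketTensor_cons, mul_assoc]
    have h2 := ih (Fin.tail i) (Fin.tail j)
    rw [braket] at h2
    rw [h, Psi_star_mul]
    have h3 : i = j ↔ i 0 = j 0 ∧ Fin.tail i = Fin.tail j := by
      rw [← Fin.cons_self_tail i, ← Fin.cons_self_tail j, Fin.cons_inj]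
      simp
    by_cases h0 : i 0 = j 0
    · simp only [h3, h0, if_true, one_mul, h2, true_and]
    · simp only [h3, h0, if_false, zero_mul, mul_zero, Finset.sum_const_zero, false_and]

theorem phi_apply (k : Fin (n + 1)) (I : Fin n → Fin 4) :
    phi θ n k I = ∑ i, symCoord k i • ketTensor θ i I := by
  simp only [symCoord_eq, ← mem_arrangements, ite_smul, zero_smul]
  rw [Finset.sum_ite_mem, Finset.univ_inter, ← Finset.smul_sum, phi, Pi.smul_apply,
    Finset.sum_apply]

theorem braket_phi_ketTensor (k : Fin (n + 1)) (j : Fin n → Fin 2) :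
    braket (phi θ n k) (ketTensor θ j) = algebraMap ℂ _ (symCoord k j) := by
  have h : braket (phi θ n k) (ketTensor θ j) =
      ∑ i, symCoord k i • braket (ketTensor θ i) (ketTensor θ j) := by
    simp only [braket, phi_apply, star_sum, star_smul, star_symCoord, Finset.sum_mul,
      smul_mul_assoc, Finset.smul_sum]
    exact Finset.sum_comm
  rw [h]
  simp only [braket_ketTensor, smul_ite, smul_zero, Finset.sum_ite_eq', Finset.mem_univ, if_true]
  rw [Algebra.algebraMap_eq_smul_one]

theorem braket_phi_phi (k l : Fin (n + 1)) :
    braket (phi θ n k) (phi θ n l) = if k = l then 1 else 0 := by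
  have h : braket (phi θ n k) (phi θ n l) =
      ∑ j, symCoord l j • braket (phi θ n k) (ketTensor θ j) := by
    simp only [braket, phi_apply θ l, Finset.mul_sum, mul_smul_comm, Finset.smul_sum]
    exact Finset.sum_comm
  simp only [h, braket_phi_ketTensor, Algebra.smul_def, ← map_mul, ← map_sum,
    sum_symCoord_mul_symCoord, eq_comm (a := l)]
  split_ifs <;> simp

end braket

/-! ### Equivariant maps -/

/-- The first isomorphism theorem for two maps with equal fibres: the chosen preimages do not affect
the value of `g`. -/
theorem exists_rangeEquiv {R M N K : Type} [Semiring R] [AddCommMonoid M] [AddCommMonoid N]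
    [AddCommMonoid K] [Module R M] [Module R N] [Module R K] (f : M →ₗ[R] N) (g : M →ₗ[R] K)
    (h : ∀ x y, f x = f y ↔ g x = g y) (hg : Function.Surjective g) :
    ∃ e : LinearMap.range f ≃ₗ[R] K, ∀ x, e ⟨f x, LinearMap.mem_range_self f x⟩ = g x := by
  choose s hs using fun y : LinearMap.range f => y.2
  let φ : LinearMap.range f →ₗ[R] K :=
    { toFun := fun y => g (s y)
      map_add' := fun y z => by
        rw [← map_add]
        exact (h _ _).1 (by rw [map_add, hs, hs, hs]; rfl)
      map_smul' := fun c y => by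
        rw [RingHom.id_apply, ← map_smul]
        exact (h _ _).1 (by rw [map_smul, hs, hs]; rfl) }
  have hφ (x : M) : φ ⟨f x, LinearMap.mem_range_self f x⟩ = g x := (h _ _).1 (hs _)
  refine ⟨LinearEquiv.ofBijective φ ⟨?_, fun k => ?_⟩, hφ⟩
  · rintro ⟨_, x, rfl⟩ ⟨_, y, rfl⟩ hxy
    rw [hφ, hφ] at hxy
    exact Subtype.ext ((h x y).2 hxy)
  · obtain ⟨x, rfl⟩ := hg k
    exact ⟨_, hφ x⟩

section equivariant

variable (θ : ℝ) {n : ℕ}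

/-- The coordinate with index `i` of an element of `A(S_{θ'}^7) ⊗ Sym^n(ℂ²)`. -/
def tcoord (i : Fin n → Fin 2) : A7 θ ⊗[ℂ] SymPow n →ₗ[ℂ] A7 θ :=
  TensorProduct.lift (LinearMap.mk₂ ℂ (fun a v => (v : (Fin n → Fin 2) → ℂ) i • a)
    (fun a b v => smul_add _ a b) (fun c a v => smul_comm _ c a)
    (fun a v v' => by simp [add_smul]) (fun c a v => by simp [mul_smul]))

theorem tcoord_tmul (i : Fin n → Fin 2) (a : A7 θ) (v : SymPow n) :
    tcoord θ i (a ⊗ₜ v) = (v : (Fin n → Fin 2) → ℂ) i • a := rfl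

theorem tcoord_tmul_symBasis (i : Fin n → Fin 2) (a : A7 θ) (k : Fin (n + 1)) :
    tcoord θ i (a ⊗ₜ symBasis n k) = symCoord k i • a := rfl

/-- Symmetric tensors are reproduced by their coefficients along the `symBasis n k`, so an element
is recovered from its coordinates and may be handled through them alone. -/
theorem sum_tcoord (x : A7 θ ⊗[ℂ] SymPow n) :
    ∑ k, (∑ i, symCoord k i • tcoord θ i x) ⊗ₜ[ℂ] symBasis n k = x := by
  induction x with
  | zero => simp
  | add x y hx hy =>
    conv_rhs => rw [← hx, ← hy]
    simp only [map_add, smul_add, Finset.sum_add_distrib, TensorProduct.add_tmul]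
  | tmul a v =>
    have hv : ∑ k, (∑ i, symCoord k i * (v : (Fin n → Fin 2) → ℂ) i) • symBasis n k = v := by
      ext i
      rw [← sum_symCoord_mul v.2 i]
      simp [symCoord, mul_comm]
    conv_rhs => rw [← hv, TensorProduct.tmul_sum]
    refine Finset.sum_congr rfl fun k _ => ?_
    rw [TensorProduct.tmul_smul, TensorProduct.smul_tmul']
    simp only [tcoord_tmul, smul_smul, Finset.sum_smul]

theorem ext_tcoord {x y : A7 θ ⊗[ℂ] SymPow n} (h : ∀ i, tcoord θ i x = tcoord θ i y) : x = y := by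
  rw [← sum_tcoord θ x, ← sum_tcoord θ y]
  simp only [h]

theorem mem_Equivariant_iff (x : A7 θ ⊗[ℂ] SymPow n) : x ∈ Equivariant θ n ↔
    ∀ (w : SU2) (i : Fin n → Fin 2), alpha θ w (tcoord θ i x) =
      ∑ j, tensorMat n ((w⁻¹ : SU2) : Matrix (Fin 2) (Fin 2) ℂ) i j • tcoord θ j x := by
  have h1 (w : SU2) (i : Fin n → Fin 2) (x : A7 θ ⊗[ℂ] SymPow n) :
      tcoord θ i (TensorProduct.map ((alpha θ w : A7 θ →ₐ[ℂ] A7 θ).toLinearMap) LinearMap.id x) =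
        alpha θ w (tcoord θ i x) := by
    induction x with
    | zero => simp
    | add x y hx hy => simp only [map_add, hx, hy]
    | tmul a v => simp [tcoord_tmul]
  have h2 (w : SU2) (i : Fin n → Fin 2) (x : A7 θ ⊗[ℂ] SymPow n) :
      tcoord θ i (TensorProduct.map LinearMap.id (rho n w) x) =
        ∑ j, tensorMat n (w : Matrix (Fin 2) (Fin 2) ℂ) i j • tcoord θ j x := by
    induction x with
    | zero => simp
    | add x y hx hy => simp only [map_add, hx, hy, smul_add, Finset.sum_add_distrib]
    | tmul a v =>
      rw [TensorProduct.map_tmul, tcoord_tmul]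
      have : (rho n w v : (Fin n → Fin 2) → ℂ) i =
          ∑ j, tensorMat n (w : Matrix (Fin 2) (Fin 2) ℂ) i j * (v : (Fin n → Fin 2) → ℂ) j :=
        tensorOp_apply n _ _ i
      rw [this, Finset.sum_smul]
      simp only [tcoord_tmul, smul_smul, LinearMap.id_apply]
  constructor
  · intro h w i
    rw [← h1, h w, h2]
  · intro h w
    refine ext_tcoord θ fun i => ?_
    rw [h1, h2, h]

-- The tensors of columns transform by w ⊗ ⋯ ⊗ w and the coordinates by its inverse, so the pairing
-- is invariant and `mem_base_of_invariant` applies.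
variable {θ} in
theorem sum_ketTensor_mul_tcoord_mem_base {x : A7 θ ⊗[ℂ] SymPow n} (hx : x ∈ Equivariant θ n)
    (I : Fin n → Fin 4) : ∑ i, ketTensor θ i I * tcoord θ i x ∈ base θ := by
  refine mem_base_of_invariant θ fun w => ?_
  rw [mem_Equivariant_iff] at hx
  have hT (j l : Fin n → Fin 2) : ∑ i, tensorMat n (w : Matrix (Fin 2) (Fin 2) ℂ) j i *
      tensorMat n ((w⁻¹ : SU2) : Matrix (Fin 2) (Fin 2) ℂ) i l = if j = l then 1 else 0 := by
    rw [← Matrix.mul_apply, tensorMat_mul_inv, Matrix.one_apply]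
  have h (i : Fin n → Fin 2) : alpha θ w (ketTensor θ i I) =
      ∑ j, tensorMat n (w : Matrix (Fin 2) (Fin 2) ℂ) j i • ketTensor θ j I :=
    alpha_ketTensor θ w i I
  calc alpha θ w (∑ i, ketTensor θ i I * tcoord θ i x)
      = ∑ i, ∑ j, ∑ l, (tensorMat n (w : Matrix (Fin 2) (Fin 2) ℂ) j i *
          tensorMat n ((w⁻¹ : SU2) : Matrix (Fin 2) (Fin 2) ℂ) i l) •
          (ketTensor θ j I * tcoord θ l x) := by
        simp only [map_sum, map_mul, h, hx, Finset.sum_mul_sum, smul_mul_assoc, mul_smul_comm,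
          smul_smul, mul_comm]
    _ = ∑ j, ∑ l, (∑ i, tensorMat n (w : Matrix (Fin 2) (Fin 2) ℂ) j i *
          tensorMat n ((w⁻¹ : SU2) : Matrix (Fin 2) (Fin 2) ℂ) i l) •
          (ketTensor θ j I * tcoord θ l x) := by
        rw [Finset.sum_comm]
        refine Finset.sum_congr rfl fun j _ => ?_
        rw [Finset.sum_comm]
        simp only [Finset.sum_smul]
    _ = ∑ i, ketTensor θ i I * tcoord θ i x := by
        simp only [hT, ite_smul, one_smul, zero_smul, Finset.sum_ite_eq, Finset.mem_univ, if_true]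

/-- The equivariant map `∑_k φ_k(J)^* ⊗ e_k`. -/
def braKet (J : Fin n → Fin 4) : A7 θ ⊗[ℂ] SymPow n :=
  ∑ k, star (phi θ n k J) ⊗ₜ symBasis n k

theorem tcoord_braKet (J : Fin n → Fin 4) (i : Fin n → Fin 2) :
    tcoord θ i (braKet θ J) = ∑ k, symCoord k i • star (phi θ n k J) := by
  simp only [braKet, map_sum, tcoord_tmul_symBasis]

theorem tcoord_braKet_eq_sum (J : Fin n → Fin 4) (i : Fin n → Fin 2) :
    tcoord θ i (braKet θ J) = ∑ j, symProj n i j • star (ketTensor θ j J) := by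
  simp only [tcoord_braKet, phi_apply, star_sum, star_smul, star_symCoord, Finset.smul_sum,
    smul_smul, symProj, Matrix.of_apply, Finset.sum_smul]
  exact Finset.sum_comm

/-- Taking adjoints turns the matrix of w into that of w⁻¹ by unitarity, and the projection onto
symmetric tensors commutes with it. -/
theorem braKet_mem (J : Fin n → Fin 4) : braKet θ J ∈ Equivariant θ n := by
  rw [mem_Equivariant_iff]
  intro w i
  set T := tensorMat n ((w⁻¹ : SU2) : Matrix (Fin 2) (Fin 2) ℂ) with hT
  have h1 (j : Fin n → Fin 2) : alpha θ w (star (ketTensor θ j J)) =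
      ∑ l, T j l • star (ketTensor θ l J) := by
    rw [map_star, alpha_ketTensor, star_sum]
    refine Finset.sum_congr rfl fun l _ => ?_
    rw [star_smul, hT, ← tensorMat_conjTranspose]
    rfl
  have h2 (l : Fin n → Fin 2) : (∑ j, symProj n i j * T j l) = ∑ j, T i j * symProj n j l := by
    rw [← Matrix.mul_apply, ← Matrix.mul_apply, hT, symProj_mul_tensorMat]
  simp only [tcoord_braKet_eq_sum, map_sum, map_smul, h1, Finset.smul_sum, smul_smul]
  rw [Finset.sum_comm]
  conv_rhs => rw [Finset.sum_comm]
  refine Finset.sum_congr rfl fun l _ => ?_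
  rw [← Finset.sum_smul, h2, Finset.sum_smul]

/-- Column `J` of the projection corresponds to the equivariant element `braKet θ J`; its pairing
with the tensors in row `I` is the entry. -/
theorem projN_mem_base (I J : Fin n → Fin 4) : projN θ n I J ∈ base θ := by
  have h := sum_ketTensor_mul_tcoord_mem_base (braKet_mem θ J) I
  convert h using 1
  simp only [projN, Matrix.of_apply, tcoord_braKet, phi_apply θ _ I, Finset.sum_mul,
    Finset.mul_sum, smul_mul_assoc, mul_smul_comm]
  exact Finset.sum_comm

theorem projN_mul_projN : projN θ n * projN θ n = projN θ n := by
  ext I L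
  have h : (projN θ n * projN θ n) I L = ∑ k, ∑ l, phi θ n k I *
      (braket (phi θ n k) (phi θ n l)) * star (phi θ n l L) := by
    simp only [Matrix.mul_apply, projN, Matrix.of_apply, Finset.sum_mul_sum]
    simp only [braket, Finset.mul_sum, Finset.sum_mul, mul_assoc]
    rw [Finset.sum_comm]
    exact Finset.sum_congr rfl fun k _ => Finset.sum_comm
  rw [h]
  simp [braket_phi_phi, projN]

theorem projN_conjTranspose : (projN θ n).conjTranspose = projN θ n := by
  ext I J
  simp [projN, Matrix.conjTranspose_apply]

theorem projN_mulVec (g : (Fin n → Fin 4) → A7 θ) (I : Fin n → Fin 4) :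
    (projN θ n).mulVec g I = ∑ k, phi θ n k I * braket (phi θ n k) g := by
  simp only [Matrix.mulVec, dotProduct, projN, Matrix.of_apply, braket, Finset.sum_mul,
    Finset.mul_sum, mul_assoc]
  exact Finset.sum_comm

theorem braket_projN_mulVec (k : Fin (n + 1)) (g : (Fin n → Fin 4) → A7 θ) :
    braket (phi θ n k) ((projN θ n).mulVec g) = braket (phi θ n k) g := by
  have h : braket (phi θ n k) ((projN θ n).mulVec g) =
      ∑ l, braket (phi θ n k) (phi θ n l) * braket (phi θ n l) g := by
    simp only [braket.eq_1 (phi θ n k), projN_mulVec, Finset.mul_sum, Finset.sum_mul, mul_assoc]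
    exact Finset.sum_comm
  simp [h, braket_phi_phi]

/-- The map `|f⟩ ↦ ∑_k ⟨φ_k|f⟩ ⊗ e_k` to equivariant maps. -/
def braMap (n : ℕ) : ((Fin n → Fin 4) → A4 θ) →ₗ[(A4 θ)ᵐᵒᵖ] Equivariant θ n where
  -- As a combination of equivariant elements with coefficients from the base, the value is
  -- equivariant without further check.
  toFun f := ∑ J, MulOpposite.op (f J) • ⟨braKet θ J, braKet_mem θ J⟩
  map_add' f g := by
    simp only [Pi.add_apply, MulOpposite.op_add, add_smul, Finset.sum_add_distrib]
  map_smul' c f := by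
    obtain ⟨c, rfl⟩ := MulOpposite.op_surjective c
    simp only [Pi.smul_apply, MulOpposite.smul_eq_mul_unop, MulOpposite.unop_op, MulOpposite.op_mul,
      mul_smul, Finset.smul_sum, RingHom.id_apply]

theorem coe_braMap (f : (Fin n → Fin 4) → A4 θ) : (braMap θ n f : A7 θ ⊗[ℂ] SymPow n) =
    ∑ k, braket (phi θ n k) (fun I => hopf θ (f I)) ⊗ₜ[ℂ] symBasis n k := by
  have h : (braMap θ n f : A7 θ ⊗[ℂ] SymPow n) = ∑ J, MulOpposite.op (f J) • braKet θ J := by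
    simp [braMap]
  rw [h]
  simp only [braKet, Finset.smul_sum, TensorProduct.smul_tmul', op_smul_def, braket,
    TensorProduct.sum_tmul]
  exact Finset.sum_comm

theorem braMap_eq_iff (f g : (Fin n → Fin 4) → A4 θ) : braMap θ n f = braMap θ n g ↔
    ∀ k, braket (phi θ n k) (fun I => hopf θ (f I)) =
      braket (phi θ n k) (fun I => hopf θ (g I)) := by
  have key (f : (Fin n → Fin 4) → A4 θ) (k : Fin (n + 1)) :
      ∑ i, symCoord k i • tcoord θ i (braMap θ n f : A7 θ ⊗[ℂ] SymPow n) =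
        braket (phi θ n k) (fun I => hopf θ (f I)) := by
    simp only [coe_braMap, map_sum, tcoord_tmul_symBasis, Finset.smul_sum, smul_smul]
    rw [Finset.sum_comm]
    simp only [← Finset.sum_smul, sum_symCoord_mul_symCoord, ite_smul, one_smul, zero_smul,
      Finset.sum_ite_eq, Finset.mem_univ, if_true]
  constructor
  · intro h k
    rw [← key, ← key, h]
  · intro h
    exact Subtype.ext (by rw [coe_braMap, coe_braMap]; simp only [h])

/-- For x with coordinates x_i, the preimage is f_I = ∑ ψ_i(I) x_i with ψ_i the tensors of columns.
It has entries in the base, and orthonormality turns ⟨φ_k|f⟩ into the k-th coefficient of x. -/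
theorem braMap_surjective : Function.Surjective (braMap θ n) := by
  intro x
  choose f hf using fun I => mem_base θ |>.1 (sum_ketTensor_mul_tcoord_mem_base x.2 I)
  refine ⟨f, Subtype.ext ?_⟩
  rw [coe_braMap]
  conv_rhs => rw [← sum_tcoord θ x.1]
  refine Finset.sum_congr rfl fun k _ => ?_
  congr 1
  have h : braket (phi θ n k) (fun I => hopf θ (f I)) =
      ∑ i, braket (phi θ n k) (ketTensor θ i) * tcoord θ i x.1 := by
    simp only [braket, hf, Finset.mul_sum, Finset.sum_mul, mul_assoc]
    exact Finset.sum_comm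
  simp only [h, braket_phi_ketTensor, ← Algebra.smul_def]

end equivariant

end NCHopf

end

/-! ### Descent of the projection to A(S^4) and the isomorphism. -/

theorem mainTheorem10 (θ : ℝ) (n : ℕ) (hn : 1 ≤ n) :
    Function.Injective (hopf θ) ∧
    ∃ P : Matrix (Fin n → Fin 4) (Fin n → Fin 4) (A4 θ),
      P.map (hopf θ) = projN θ n ∧ P * P = P ∧ P.conjTranspose = P ∧
      ∃ e : LinearMap.range (colMap P) ≃ₗ[(A4 θ)ᵐᵒᵖ] Equivariant θ n,
        ∀ f : (Fin n → Fin 4) → A4 θ,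
          (e ⟨colMap P f, LinearMap.mem_range_self _ f⟩ : A7 θ ⊗[ℂ] SymPow n) =
            ∑ k, braket (phi θ n k) (fun I => hopf θ (f I)) ⊗ₜ[ℂ] symBasis n k := by
  have hinj := hopf_injective θ
  refine ⟨hinj, ?_⟩
  choose p hp using fun I J => (mem_base θ).1 (projN_mem_base (n := n) θ I J)
  set P : Matrix (Fin n → Fin 4) (Fin n → Fin 4) (A4 θ) := Matrix.of p
  have hP : P.map (hopf θ) = projN θ n := by
    ext I J
    exact hp I J
  -- Identities for `P` are checked in A(S^7), where the vectors φ_k live.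
  have hinjM : Function.Injective
      (fun M : Matrix (Fin n → Fin 4) (Fin n → Fin 4) (A4 θ) => M.map (hopf θ)) :=
    Matrix.map_injective hinj
  have hvec (f : (Fin n → Fin 4) → A4 θ) :
      (fun I => hopf θ (colMap P f I)) = (projN θ n).mulVec fun I => hopf θ (f I) := by
    funext I
    simp only [colMap, LinearMap.coe_mk, AddHom.coe_mk, Matrix.mulVec, dotProduct, map_sum, map_mul,
      ← hP, Matrix.map_apply]
  -- The vector p|f⟩ = ∑ φ_k⟨φ_k|f⟩ is determined by the coefficients ⟨φ_k|f⟩, and conversely ⟨φ_k|p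
  -- f⟩ = ⟨φ_k|f⟩.
  have hker (f g : (Fin n → Fin 4) → A4 θ) :
      colMap P f = colMap P g ↔ braMap θ n f = braMap θ n g := by
    rw [braMap_eq_iff]
    constructor
    · intro h k
      rw [← braket_projN_mulVec, ← hvec, h, hvec, braket_projN_mulVec]
    · intro h
      funext I
      apply hinj
      have h1 := congrFun (hvec f) I
      have h2 := congrFun (hvec g) I
      rw [projN_mulVec] at h1 h2
      rw [h1, h2]
      simp only [h]
  obtain ⟨e, he⟩ := exists_rangeEquiv (colMap P) (braMap θ n) hker (braMap_surjective θ)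
  refine ⟨P, hP, hinjM ?_, hinjM ?_, e, fun f => ?_⟩
  · change (P * P).map (hopf θ) = P.map (hopf θ)
    rw [Matrix.map_mul, hP, projN_mul_projN]
  · change P.conjTranspose.map (hopf θ) = P.map (hopf θ)
    rw [Matrix.conjTranspose_map _ (fun x => map_star (hopf θ) x), hP, projN_conjTranspose]
  · rw [he, coe_braMap]
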